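/- Let $f(m)=-\tfrac23 m^{3/2}$ for $m\ge 0$, let $\mathbb{R}_+=(0,\infty)$ and $\Omega=\mathbb{R}^2_+=(0,\infty)\times(0,\infty)$, with points written $(x,t)$. Let $m_0\in L^\infty(\mathbb{R}_+)$ satisfy $m_0\ge 0$ and $m_0(x+h)\ge m_0(x)$ for all $x>0$ and $h>0$. Then there is one and, up to equality almost everywhere in $\Omega$, only one function $m\in L^\infty(\Omega)$ with $m\ge 0$ that is a weak solution of the conservation law $$m_{t}+f(m)_{x}=0 \quad\text{on } \Omega,\qquad m(x,0)=m_0(x),$$ and satisfies $m(x+h,t)\ge m(x,t)$ for all $h>0$ and all $(x,t)\in\Omega$. Here a weak solution with initial values $m_0$ is one for which $$\int_\Omega\bigl(m\,\psi_{t}+f(m)\,\psi_{x}\bigr)\,dx\,dt+\int_0^\infty m_0(x)\,\psi(x,0)\,dx=0$$ for every $\psi\in C^\infty_0\bigl((0,\infty)\times\mathbb{R}\bigr)$; no condition is imposed on the boundary $x=0$. -/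

import Mathlib

open MeasureTheory Set
open scoped ContDiff

namespace ShellCrossing

noncomputable section

/-- The flux `f(m) = -(2/3) m^{3/2}`; it is only applied to values `m ≥ 0`. -/
def flux (m : ℝ) : ℝ := -(2 / 3) * m ^ (3 / 2 : ℝ)

/-- The open quadrant `{(x, t) : x > 0, t > 0}`. -/
def quadrant : Set (ℝ × ℝ) := Ioi 0 ×ˢ Ioi 0

/-- Test functions for the initial value problem on the quadrant: (restrictions to `t ≥ 0` of)
smooth functions of `(x, t)` whose compact support lies in `{x > 0}`. They vanish near `x = 0`
but need not vanish at `t = 0`. -/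
structure IsTestFunction (ψ : ℝ × ℝ → ℝ) : Prop where
  smooth : ContDiff ℝ ∞ ψ
  compactSupport : HasCompactSupport ψ
  support_subset : tsupport ψ ⊆ Ioi 0 ×ˢ univ

/-- `m` is a (nonnegative) `L^∞` weak solution of `m_t + f(m)_x = 0` on the quadrant with initial
values `m₀` at `t = 0`:
`∬ (m ψ_t + f(m) ψ_x) dx dt + ∫ m₀(x) ψ(x, 0) dx = 0` for every test function `ψ`. -/
structure IsWeakSolution (m₀ : ℝ → ℝ) (m : ℝ × ℝ → ℝ) : Prop where
  memLp : MemLp m ⊤ (volume.restrict quadrant)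
  nonneg : ∀ p ∈ quadrant, 0 ≤ m p
  weak_eq : ∀ ψ : ℝ × ℝ → ℝ, IsTestFunction ψ →
    (∫ p in quadrant, (m p * deriv (fun t => ψ (p.1, t)) p.2
        + flux (m p) * deriv (fun x => ψ (x, p.2)) p.1))
      + ∫ x in Ioi (0 : ℝ), m₀ x * ψ (x, 0) = 0

/-- A weak solution with `m(x + h, t) ≥ m(x, t)` for all `h > 0` and all `x, t > 0`. -/
structure IsPositiveDensitySolution (m₀ : ℝ → ℝ) (m : ℝ × ℝ → ℝ) : Prop where
  isWeakSolution : IsWeakSolution m₀ m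
  mono : ∀ x t h : ℝ, 0 < x → 0 < t → 0 < h → m (x, t) ≤ m (x + h, t)

end

end ShellCrossing

namespace ShellCrossing

open Filter Topology Real

/-! Existence. Extend `m₀` by zero to a bounded monotone `v` on the line; its primitive is convex.
The supremum `hopf v` of the planes with slopes `(v y, -flux (v y))` touching this primitive at time
zero is Lipschitz, and by compactness it has at every point a subgradient of the form `(p, -flux p)`
(`hopf_subgradient`). By Rademacher's theorem its gradient is therefore `(m, -flux m)` almost
everywhere, and equality of mixed derivatives in the weak sense (`integral_lineDeriv_curl_eq_zero`)
is the conservation law for `m`. Convexity in `x` makes `m` monotone.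

Uniqueness. The difference `δ` of two solutions satisfies `δ_t = (b δ)_x` weakly with zero initial
values, where `b` is the secant slope of `-flux` between them. Since both solutions increase in `x`,
so does `b`; moreover `0 ≤ b ≤ L`. A potential `W` with `W_x = δ`, `W_t = b δ` is transported by
`W_t = b W_x`. Integrating by parts, `∫ b (W²)_x` is at most zero up to the right end, because `b`
increases and the boundary term at the left end has the favourable sign: waves move left and leave
through `x = 0`, so no boundary condition is needed. A cutoff receding at speed `L` localizes the
estimate on the right, giving `W = 0` and `δ = 0`.

Since `δ` is only bounded, `W` is replaced by mollified potentials (`energy_estimate`); the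
commutator error tends to zero by Lebesgue differentiation, and `ae_eq_zero_of_transport` passes to
the limit. -/

lemma flux_nonpos {p : ℝ} (hp : 0 ≤ p) : flux p ≤ 0 := by
  unfold flux
  have := Real.rpow_nonneg hp (3 / 2)
  linarith

lemma continuous_flux : Continuous flux := by
  unfold flux
  exact continuous_const.mul (continuous_id.rpow_const fun _ => Or.inr (by norm_num))

lemma flux_anti {p q : ℝ} (hp : 0 ≤ p) (hpq : p ≤ q) : flux q ≤ flux p := by
  unfold flux
  have := Real.rpow_le_rpow hp hpq (by norm_num : (0 : ℝ) ≤ 3 / 2)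
  linarith

/-! ### The Hopf potential and its subgradients. -/

/-- A primitive of `v`. -/
noncomputable def primitive (v : ℝ → ℝ) (x : ℝ) : ℝ := ∫ s in (0 : ℝ)..x, v s

lemma primitive_subgradient {v : ℝ → ℝ} (hv : Monotone v) (x y : ℝ) :
    primitive v y + v y * (x - y) ≤ primitive v x := by
  have hi : ∀ a b : ℝ, IntervalIntegrable v volume a b := fun a b => hv.intervalIntegrable
  have h : primitive v x - primitive v y = ∫ s in y..x, v s :=
    intervalIntegral.integral_interval_sub_left (hi _ _) (hi _ _)
  rcases le_total y x with hyx | hxy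
  · have h2 : ∫ _ in y..x, v y ≤ ∫ s in y..x, v s :=
      intervalIntegral.integral_mono_on hyx (by simp) (hi _ _) fun s hs => hv hs.1
    simp only [intervalIntegral.integral_const, smul_eq_mul] at h2
    linarith
  · have h2 : ∫ s in x..y, v s ≤ ∫ _ in x..y, v y :=
      intervalIntegral.integral_mono_on hxy (hi _ _) (by simp) fun s hs => hv hs.2
    rw [intervalIntegral.integral_symm] at h
    simp only [intervalIntegral.integral_const, smul_eq_mul] at h2
    linarith

/-- The plane with slopes `(v y, -flux (v y))` that touches the primitive of `v` at `(y, 0)`. -/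
noncomputable def plane (v : ℝ → ℝ) (y : ℝ) (z : ℝ × ℝ) : ℝ :=
  primitive v y + v y * (z.1 - y) + -flux (v y) * z.2

/-- The Hopf formula for the potential of the conservation law with initial density `v`. -/
noncomputable def hopf (v : ℝ → ℝ) (z : ℝ × ℝ) : ℝ := ⨆ y : ℝ, plane v y z

section Hopf

variable {v : ℝ → ℝ} {P : ℝ}

lemma bddAbove_plane (hv : Monotone v) (h0 : ∀ x, 0 ≤ v x) (hP : ∀ x, v x ≤ P) (z : ℝ × ℝ) :
    BddAbove (range fun y => plane v y z) := by
  refine ⟨primitive v z.1 + -flux P * |z.2|, ?_⟩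
  rintro _ ⟨y, rfl⟩
  have h1 := primitive_subgradient hv z.1 y
  have h2 : -flux (v y) * z.2 ≤ -flux (v y) * |z.2| :=
    mul_le_mul_of_nonneg_left (le_abs_self _) (by linarith [flux_nonpos (h0 y)])
  have h3 : -flux (v y) * |z.2| ≤ -flux P * |z.2| :=
    mul_le_mul_of_nonneg_right (by linarith [flux_anti (h0 y) (hP y)]) (abs_nonneg _)
  simp only [plane]
  linarith

lemma hopf_zero (hv : Monotone v) (x : ℝ) : hopf v (x, 0) = primitive v x := by
  unfold hopf plane
  refine le_antisymm (ciSup_le fun y => ?_) ?_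
  · simpa using primitive_subgradient hv x y
  · have : BddAbove (range fun y => primitive v y + v y * (x - y) + -flux (v y) * 0) := by
      refine ⟨primitive v x, ?_⟩
      rintro _ ⟨y, rfl⟩
      simpa using primitive_subgradient hv x y
    exact (le_ciSup this x).trans' (by simp)

/-- The supremum need not be attained, so planes that are almost optimal at `z` are taken. Their
slopes `v (y n)` lie in the compact interval `[0, P]`; along a convergent subsequence the planes,
all below `hopf v`, tend to a supporting plane at `z`. -/
lemma hopf_subgradient (hv : Monotone v) (h0 : ∀ x, 0 ≤ v x) (hP : ∀ x, v x ≤ P) (z : ℝ × ℝ) :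
    ∃ p ∈ Icc 0 P, ∀ w : ℝ × ℝ,
      hopf v z + p * (w.1 - z.1) + -flux p * (w.2 - z.2) ≤ hopf v w := by
  have hex : ∀ n : ℕ, ∃ y, hopf v z - 1 / ((n : ℝ) + 1) < plane v y z := fun n =>
    exists_lt_of_lt_ciSup (sub_lt_self _ (by positivity))
  choose y hy using hex
  obtain ⟨p, hp, φ, hφ, hlim⟩ := isCompact_Icc.tendsto_subseq
    (x := fun n => v (y n)) (s := Icc 0 P) fun n => ⟨h0 _, hP _⟩
  refine ⟨p, hp, fun w => ?_⟩
  have h1 : Tendsto (fun n => 1 / ((φ n : ℝ) + 1)) atTop (𝓝 0) :=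
    tendsto_one_div_add_atTop_nhds_zero_nat.comp hφ.tendsto_atTop
  have h2 : Tendsto (fun n => -flux (v (y (φ n)))) atTop (𝓝 (-flux p)) :=
    ((continuous_flux.tendsto p).comp hlim).neg
  have h3 := (((tendsto_const_nhds (x := hopf v z)).sub h1).add
    (hlim.mul_const (w.1 - z.1))).add (h2.mul_const (w.2 - z.2))
  rw [sub_zero] at h3
  refine le_of_tendsto' h3 fun n => ?_
  have h4 := le_ciSup (bddAbove_plane hv h0 hP w) (y (φ n))
  have h5 := hy (φ n)
  simp only [plane, Function.comp] at h4 h5 ⊢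
  unfold hopf at *
  simp only [plane] at *
  linarith

lemma abs_hopf_sub_le (hv : Monotone v) (h0 : ∀ x, 0 ≤ v x) (hP : ∀ x, v x ≤ P) (z w : ℝ × ℝ) :
    hopf v z - hopf v w ≤ (P + -flux P) * dist z w := by
  obtain ⟨p, hp, h⟩ := hopf_subgradient hv h0 hP z
  have hw := h w
  have d1 : |z.1 - w.1| ≤ dist z w := le_max_left (dist z.1 w.1) (dist z.2 w.2)
  have d2 : |z.2 - w.2| ≤ dist z w := le_max_right (dist z.1 w.1) (dist z.2 w.2)
  have f1 := flux_nonpos hp.1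
  have f2 := flux_anti hp.1 hp.2
  have a1 : p * (z.1 - w.1) ≤ P * dist z w :=
    (mul_le_mul_of_nonneg_left ((le_abs_self _).trans d1) hp.1).trans
      (mul_le_mul_of_nonneg_right hp.2 dist_nonneg)
  have a2 : -flux p * (z.2 - w.2) ≤ -flux P * dist z w :=
    (mul_le_mul_of_nonneg_left ((le_abs_self _).trans d2) (by linarith)).trans
        (mul_le_mul_of_nonneg_right (by linarith) dist_nonneg)
  linarith

lemma lipschitzWith_hopf (hv : Monotone v) (h0 : ∀ x, 0 ≤ v x) (hP : ∀ x, v x ≤ P) :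
    LipschitzWith (P + -flux P).toNNReal (hopf v) := by
  refine LipschitzWith.of_le_add_mul _ fun z w => ?_
  have hP0 : 0 ≤ P := (h0 0).trans (hP 0)
  rw [Real.coe_toNNReal _ (by linarith [flux_nonpos hP0])]
  linarith [abs_hopf_sub_le hv h0 hP z w]

/-- At a point of differentiability the derivative is determined by any subgradient. -/
lemma lineDeriv_eq_of_subgradient {f : ℝ × ℝ → ℝ} {z e : ℝ × ℝ} {c : ℝ}
    (hf : DifferentiableAt ℝ f z) (h : ∀ s : ℝ, f z + s * c ≤ f (z + s • e)) :
    lineDeriv ℝ f z e = c := by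
  have h1 : HasDerivAt (fun s : ℝ => f (z + s • e) - s * c) (lineDeriv ℝ f z e - c) 0 := by
    have h2 : HasDerivAt (fun s : ℝ => f (z + s • e)) (lineDeriv ℝ f z e) 0 :=
      hf.lineDifferentiableAt.hasLineDerivAt
    have h3 := h2.fun_sub ((hasDerivAt_id (0 : ℝ)).mul_const c)
    rw [one_mul] at h3
    exact h3
  have h3 : IsLocalMin (fun s : ℝ => f (z + s • e) - s * c) 0 := by
    refine Filter.Eventually.of_forall fun s => ?_
    have := h s
    simp
    linarith
  linarith [h3.hasDerivAt_eq_zero h1]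

/-- The density belonging to the Hopf potential. -/
noncomputable def density (v : ℝ → ℝ) (z : ℝ × ℝ) : ℝ :=
  derivWithin (fun x => hopf v (x, z.2)) (Ioi z.1) z.1

lemma convexOn_hopf (hv : Monotone v) (h0 : ∀ x, 0 ≤ v x) (hP : ∀ x, v x ≤ P) (t : ℝ) :
    ConvexOn ℝ univ fun x => hopf v (x, t) := by
  refine ⟨convex_univ, fun x _ y _ a b ha hb hab => ?_⟩
  obtain ⟨p, _, h⟩ := hopf_subgradient hv h0 hP (a • x + b • y, t)
  have hx := mul_le_mul_of_nonneg_left (h (x, t)) ha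
  have hy := mul_le_mul_of_nonneg_left (h (y, t)) hb
  simp only [smul_eq_mul, sub_self, mul_zero, add_zero] at *
  have hb' : b = 1 - a := by linarith
  subst hb'
  nlinarith

lemma monotone_hopf (hv : Monotone v) (h0 : ∀ x, 0 ≤ v x) (hP : ∀ x, v x ≤ P) (t : ℝ) :
    Monotone fun x => hopf v (x, t) := by
  intro x y hxy
  obtain ⟨p, hp, h⟩ := hopf_subgradient hv h0 hP (x, t)
  have := h (y, t)
  have h2 : 0 ≤ p * (y - x) := mul_nonneg hp.1 (by linarith)
  simp only [sub_self, mul_zero, add_zero] at *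
  linarith

/-- Taking the right derivative of a convex function gives monotonicity at every point, not merely
almost everywhere. -/
lemma density_mono (hv : Monotone v) (h0 : ∀ x, 0 ≤ v x) (hP : ∀ x, v x ≤ P) {x y t : ℝ}
    (hxy : x ≤ y) : density v (x, t) ≤ density v (y, t) :=
  (convexOn_hopf hv h0 hP t).monotoneOn_rightDeriv (by simp) (by simp) hxy

lemma density_nonneg (hv : Monotone v) (h0 : ∀ x, 0 ≤ v x) (hP : ∀ x, v x ≤ P) (z : ℝ × ℝ) :
    0 ≤ density v z :=
  ((monotone_hopf hv h0 hP z.2).monotoneOn _).derivWithin_nonneg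

/-- The Hamilton–Jacobi equation `U_t + flux (U_x) = 0`: at a point of differentiability the
gradient must equal the subgradient `(p, -flux p)`. -/
lemma density_of_differentiableAt (hv : Monotone v) (h0 : ∀ x, 0 ≤ v x) (hP : ∀ x, v x ≤ P)
    {z : ℝ × ℝ} (hz : DifferentiableAt ℝ (hopf v) z) :
    density v z = lineDeriv ℝ (hopf v) z (1, 0) ∧
      -flux (density v z) = lineDeriv ℝ (hopf v) z (0, 1) ∧ density v z ≤ P := by
  obtain ⟨p, hp, h⟩ := hopf_subgradient hv h0 hP z
  have e1 : lineDeriv ℝ (hopf v) z (1, 0) = p := by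
    refine lineDeriv_eq_of_subgradient hz fun s => ?_
    have := h (z + s • (1, 0))
    simp at this
    simp
    linarith
  have e2 : lineDeriv ℝ (hopf v) z (0, 1) = -flux p := by
    refine lineDeriv_eq_of_subgradient hz fun s => ?_
    have := h (z + s • (0, 1))
    simp at this
    simp
    linarith
  have e3 : density v z = p := by
    have h2 : HasLineDerivAt ℝ (hopf v) p z (1, 0) := e1 ▸ hz.lineDifferentiableAt.hasLineDerivAt
    have h3 : HasDerivAt (fun x => hopf v (x, z.2)) p z.1 := by
      -- The base point `0` is written as `z.1 - z.1` to fit the translation that follows.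
      have h4 : HasDerivAt (fun s : ℝ => hopf v (z + s • (1, 0))) p (z.1 - z.1) := by
        rw [sub_self]; exact h2
      have h5 := h4.comp_sub_const z.1 z.1
      have h6 : (fun x => hopf v (z + (x - z.1) • (1, 0))) = fun x => hopf v (x, z.2) := by
        funext x
        congr 1
        ext <;> simp
      rwa [h6] at h5
    exact h3.hasDerivWithinAt.derivWithin (uniqueDiffWithinAt_Ioi _)
  rw [e1, e2, e3]
  exact ⟨rfl, rfl, hp.2⟩

end Hopf

/-! ### Partial derivatives and the weak curl identity. -/

section PartialDerivatives

variable {ψ : ℝ × ℝ → ℝ}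

lemma hasDerivAt_fst_slice (hψ : Differentiable ℝ ψ) (x t : ℝ) :
    HasDerivAt (fun x => ψ (x, t)) (fderiv ℝ ψ (x, t) (1, 0)) x :=
  (hψ (x, t)).hasFDerivAt.comp_hasDerivAt x ((hasDerivAt_id x).prodMk (hasDerivAt_const x t))

lemma hasDerivAt_snd_slice (hψ : Differentiable ℝ ψ) (x t : ℝ) :
    HasDerivAt (fun t => ψ (x, t)) (fderiv ℝ ψ (x, t) (0, 1)) t :=
  (hψ (x, t)).hasFDerivAt.comp_hasDerivAt t ((hasDerivAt_const t x).prodMk (hasDerivAt_id t))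

end PartialDerivatives

lemma isClosedEmbedding_mk_left (x : ℝ) : IsClosedEmbedding fun t : ℝ => (x, t) := by
  refine ⟨isEmbedding_prodMkRight x, ?_⟩
  have : range (fun t : ℝ => (x, t)) = Prod.fst ⁻¹' {x} := by
    ext ⟨a, b⟩
    simp [eq_comm]
  rw [this]
  exact isClosed_singleton.preimage continuous_fst

/-- Weak form of the symmetry of second derivatives for a Lipschitz function. -/
lemma integral_lineDeriv_curl_eq_zero {f ψ : ℝ × ℝ → ℝ} {C : NNReal} (hf : LipschitzWith C f)
    (hψ : ContDiff ℝ ∞ ψ) (hc : HasCompactSupport ψ) (e e' : ℝ × ℝ) :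
    ∫ z, lineDeriv ℝ f z e * fderiv ℝ ψ z e' = ∫ z, lineDeriv ℝ f z e' * fderiv ℝ ψ z e := by
  have hs : ∀ a : ℝ × ℝ, ContDiff ℝ ∞ fun z => fderiv ℝ ψ z a := fun a =>
    (hψ.fderiv_right (m := ∞) (by simp)).clm_apply contDiff_const
  have hcs : ∀ a : ℝ × ℝ, HasCompactSupport fun z => fderiv ℝ ψ z a := fun a =>
    hc.fderiv_apply (𝕜 := ℝ) a
  -- One integration by parts moves both derivatives to `ψ`, whose Hessian is symmetric.
  have key : ∀ a b : ℝ × ℝ, ∫ z, lineDeriv ℝ f z a * fderiv ℝ ψ z b =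
      ∫ z, -(fderiv ℝ (fderiv ℝ ψ) z a b) * f z := by
    intro a b
    obtain ⟨D, hD⟩ := ContDiff.lipschitzWith_of_hasCompactSupport (hcs b) (hs b) (by simp)
    rw [hf.integral_lineDeriv_mul_eq hD (hcs b)]
    refine integral_congr_ae (Eventually.of_forall fun z => ?_)
    have hd : DifferentiableAt ℝ (fderiv ℝ ψ) z :=
      ((hψ.fderiv_right (m := ∞) (by simp)).differentiable (by simp)) z
    simp only [((hs b).differentiable (by simp) z).lineDeriv_eq_fderiv]
    rw [fderiv_clm_apply hd (differentiableAt_const b)]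
    simp
  rw [key, key]
  refine integral_congr_ae (Eventually.of_forall fun z => ?_)
  have := (hψ.contDiffAt (x := z)).isSymmSndFDerivAt
    (by simpa using WithTop.coe_le_coe.2 (le_top : (2 : ℕ∞) ≤ ⊤))
  simp only [this.eq e e']

/-! ### Existence of a solution. -/

section Existence

variable {v : ℝ → ℝ} {P : ℝ}

/-- The Hopf potential, continued to negative times by its initial values. -/
noncomputable def hopfExt (v : ℝ → ℝ) (z : ℝ × ℝ) : ℝ := hopf v (z.1, max z.2 0)

lemma lipschitzWith_hopfExt (hv : Monotone v) (h0 : ∀ x, 0 ≤ v x) (hP : ∀ x, v x ≤ P) :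
    ∃ C, LipschitzWith C (hopfExt v) :=
  ⟨_, (lipschitzWith_hopf hv h0 hP).comp
    (LipschitzWith.prod_fst.prodMk (LipschitzWith.prod_snd.max_const 0))⟩

lemma hopfExt_eventuallyEq {z : ℝ × ℝ} (hz : 0 < z.2) :
    hopfExt v =ᶠ[𝓝 z] hopf v := by
  filter_upwards [continuous_snd.continuousAt.eventually (lt_mem_nhds hz)] with w hw
  simp only [hopfExt, max_eq_left hw.le]

/-- For nonpositive times the extension is the primitive of `v`. Since `-flux p ≥ 0`, the potential
never falls below its initial value, so the time line through `z` has a minimum at `z`. -/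
lemma lineDeriv_hopfExt_of_nonpos (hv : Monotone v) (h0 : ∀ x, 0 ≤ v x) (hP : ∀ x, v x ≤ P)
    {z : ℝ × ℝ} (hz : z.2 ≤ 0) (hd : DifferentiableAt ℝ (hopfExt v) z) :
    lineDeriv ℝ (hopfExt v) z (1, 0) = v z.1 ∧ lineDeriv ℝ (hopfExt v) z (0, 1) = 0 := by
  constructor
  · refine lineDeriv_eq_of_subgradient hd fun s => ?_
    have := primitive_subgradient hv (z.1 + s) z.1
    simp only [hopfExt, Prod.fst_add, Prod.snd_add, Prod.smul_fst, Prod.smul_snd, smul_eq_mul,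
      mul_zero, mul_one, add_zero, max_eq_right hz, hopf_zero hv]
    linarith
  · refine lineDeriv_eq_of_subgradient hd fun s => ?_
    obtain ⟨p, hp, h⟩ := hopf_subgradient hv h0 hP (z.1, 0)
    have h1 := h (z.1, max (z.2 + s) 0)
    have h2 : 0 ≤ -flux p * max (z.2 + s) 0 :=
      mul_nonneg (by linarith [flux_nonpos hp.1]) (le_max_right _ _)
    simp only [hopfExt, Prod.fst_add, Prod.snd_add, Prod.smul_fst, Prod.smul_snd, smul_eq_mul,
      mul_zero, mul_one, add_zero, max_eq_right hz]
    simp only [sub_self, mul_zero, add_zero, sub_zero] at h1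
    linarith

lemma ae_density (hv : Monotone v) (h0 : ∀ x, 0 ≤ v x) (hP : ∀ x, v x ≤ P) :
    ∀ᵐ z : ℝ × ℝ, 0 < z.2 → density v z = lineDeriv ℝ (hopfExt v) z (1, 0) ∧
      -flux (density v z) = lineDeriv ℝ (hopfExt v) z (0, 1) ∧ density v z ≤ P := by
  filter_upwards [(lipschitzWith_hopf hv h0 hP).ae_differentiableAt (μ := volume)] with z hd hz
  have he := fun e => (hopfExt_eventuallyEq (v := v) hz).lineDeriv_eq (𝕜 := ℝ) (v := e)
  rw [he, he]
  exact density_of_differentiableAt hv h0 hP hd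

lemma memLp_density (hv : Monotone v) (h0 : ∀ x, 0 ≤ v x) (hP : ∀ x, v x ≤ P) :
    MemLp (density v) ⊤ (volume.restrict quadrant) := by
  have hq : MeasurableSet quadrant := measurableSet_Ioi.prod measurableSet_Ioi
  have hae := ae_restrict_of_ae (s := quadrant) (ae_density hv h0 hP)
  have hmem := ae_restrict_mem (μ := (volume : Measure (ℝ × ℝ))) hq
  obtain ⟨C, hC⟩ := lipschitzWith_hopfExt hv h0 hP
  refine memLp_top_of_bound ?_ P ?_
  · refine AEStronglyMeasurable.congr
      (f := fun z => lineDeriv ℝ (hopfExt v) z (1, 0)) ?_ ?_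
    · exact (measurable_lineDeriv hC.continuous).aestronglyMeasurable
    · filter_upwards [hae, hmem] with z h hz
      exact (h hz.2).1.symm
  · filter_upwards [hae, hmem] with z h hz
    rw [Real.norm_of_nonneg (density_nonneg hv h0 hP z)]
    exact (h hz.2).2.2

/-- The curl identity is applied on the whole plane to `hopfExt v`. The upper half plane yields the
weak equation; in the lower one the integrand is `v ψ_t`, and integrating in time up to `0` produces
the initial term. -/
lemma density_weak_eq (hv : Monotone v) (h0 : ∀ x, 0 ≤ v x) (hP : ∀ x, v x ≤ P)
    {ψ : ℝ × ℝ → ℝ} (hψ : IsTestFunction ψ) :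
    (∫ p in quadrant, (density v p * deriv (fun t => ψ (p.1, t)) p.2
        + flux (density v p) * deriv (fun x => ψ (x, p.2)) p.1))
      + ∫ x, v x * ψ (x, 0) = 0 := by
  obtain ⟨C, hC⟩ := lipschitzWith_hopfExt hv h0 hP
  have hdiff : Differentiable ℝ ψ := hψ.smooth.differentiable (by simp)
  have hint : ∀ a b : ℝ × ℝ,
      Integrable fun z => lineDeriv ℝ (hopfExt v) z a * fderiv ℝ ψ z b := fun a b =>
    (hC.locallyIntegrable_lineDeriv a).integrable_smul_right_of_hasCompactSupport
      ((hψ.smooth.continuous_fderiv (by simp)).clm_apply continuous_const)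
      (hψ.compactSupport.fderiv_apply (𝕜 := ℝ) b)
  set I : ℝ × ℝ → ℝ := fun z => lineDeriv ℝ (hopfExt v) z (1, 0) * fderiv ℝ ψ z (0, 1) -
    lineDeriv ℝ (hopfExt v) z (0, 1) * fderiv ℝ ψ z (1, 0) with hI
  have hIint : Integrable I := (hint _ _).sub (hint _ _)
  have hzero : ∫ z, I z = 0 := by
    rw [hI, integral_sub (hint _ _) (hint _ _),
      integral_lineDeriv_curl_eq_zero hC hψ.smooth hψ.compactSupport, sub_self]
  have hm : MeasurableSet {z : ℝ × ℝ | 0 < z.2} := measurableSet_lt measurable_const measurable_snd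
  rw [← integral_add_compl hm hIint] at hzero
  have hupper : ∫ z in {z : ℝ × ℝ | 0 < z.2}, I z =
      ∫ p in quadrant, (density v p * deriv (fun t => ψ (p.1, t)) p.2
        + flux (density v p) * deriv (fun x => ψ (x, p.2)) p.1) := by
    -- The part of the half plane with `x ≤ 0` contributes nothing, as `ψ` is supported in `x > 0`.
    have hsub : quadrant ⊆ {z : ℝ × ℝ | 0 < z.2} := fun z hz => hz.2
    refine (setIntegral_eq_of_subset_of_forall_sdiff_eq_zero hm hsub ?_).trans ?_
    rotate_left
    · refine setIntegral_congr_ae (measurableSet_Ioi.prod measurableSet_Ioi) ?_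
      filter_upwards [ae_density hv h0 hP] with z hz hzq
      obtain ⟨h1, h2, -⟩ := hz hzq.2
      rw [(hasDerivAt_fst_slice hdiff z.1 z.2).deriv, (hasDerivAt_snd_slice hdiff z.1 z.2).deriv,
        hI]
      simp only [← h1, ← h2]
      ring
    · intro z hz
      have hz1 : z ∉ tsupport ψ := fun h => hz.2 ⟨(hψ.support_subset h).1, hz.1⟩
      have : fderiv ℝ ψ z = 0 := by
        by_contra h
        exact hz1 (support_fderiv_subset ℝ h)
      simp [hI, this]
  have hlower : ∫ z in {z : ℝ × ℝ | 0 < z.2}ᶜ, I z = ∫ x, v x * ψ (x, 0) := by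
    have hset : {z : ℝ × ℝ | 0 < z.2}ᶜ = univ ×ˢ Iic (0 : ℝ) := by ext; simp
    have hae : ∀ᵐ z : ℝ × ℝ, z ∈ univ ×ˢ Iic (0 : ℝ) → I z = v z.1 * fderiv ℝ ψ z (0, 1) := by
      filter_upwards [hC.ae_differentiableAt (μ := volume)] with z hd hz
      obtain ⟨h1, h2⟩ := lineDeriv_hopfExt_of_nonpos hv h0 hP hz.2 hd
      simp [hI, h1, h2]
    have hms : MeasurableSet (univ ×ˢ Iic (0 : ℝ) : Set (ℝ × ℝ)) :=
      MeasurableSet.univ.prod measurableSet_Iic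
    have hint2 : IntegrableOn (fun z : ℝ × ℝ => v z.1 * fderiv ℝ ψ z (0, 1))
        (univ ×ˢ Iic (0 : ℝ)) :=
      hIint.integrableOn.congr ((ae_restrict_iff' hms).2 hae)
    rw [hset, setIntegral_congr_ae hms hae, Measure.volume_eq_prod,
      setIntegral_prod _ (by rwa [← Measure.volume_eq_prod]), setIntegral_univ]
    refine integral_congr_ae (Eventually.of_forall fun x => ?_)
    have hcomp : HasCompactSupport fun t => ψ (x, t) :=
      hψ.compactSupport.comp_isClosedEmbedding (isClosedEmbedding_mk_left x)
    have hcd : ContDiff ℝ 1 fun t => ψ (x, t) :=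
      (hψ.smooth.of_le (by simp)).comp (contDiff_prodMk_right x)
    have := HasCompactSupport.integral_Iic_deriv_eq hcd hcomp 0
    simp only [(hasDerivAt_snd_slice hdiff x _).deriv] at this
    simp only [integral_const_mul, this]
  rw [← hupper, ← hlower, hzero]

end Existence

/-- Monotonicity upgrades the essential bound to a pointwise one: to the right of any point there is
another where the essential bound holds. -/
lemma exists_bound_of_memLp_top {m₀ : ℝ → ℝ}
    (hb : MemLp m₀ ⊤ (volume.restrict (Ioi (0 : ℝ))))
    (hm : ∀ x h : ℝ, 0 < x → 0 < h → m₀ x ≤ m₀ (x + h)) : ∃ P, ∀ x, 0 < x → m₀ x ≤ P := by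
  obtain ⟨C, hC⟩ : ∃ C : ℝ, ∀ᵐ x ∂volume.restrict (Ioi (0 : ℝ)), m₀ x ≤ C := by
    refine ⟨(eLpNormEssSup m₀ (volume.restrict (Ioi (0 : ℝ)))).toReal, ?_⟩
    have hlt : eLpNormEssSup m₀ (volume.restrict (Ioi (0 : ℝ))) < ⊤ := by
      simpa using hb.2
    filter_upwards [ae_le_eLpNormEssSup (f := m₀) (μ := volume.restrict (Ioi (0 : ℝ)))] with x hx
    have := ENNReal.toReal_mono hlt.ne hx
    rw [toReal_enorm] at this
    exact (le_abs_self _).trans this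
  refine ⟨C, fun x hx => ?_⟩
  have h2 : ∀ᵐ y ∂volume.restrict (Ioi x), m₀ y ≤ C :=
    ae_restrict_of_ae_restrict_of_subset (Ioi_subset_Ioi hx.le) hC
  have : (ae (volume.restrict (Ioi x))).NeBot := by
    rw [ae_neBot, ne_eq, Measure.restrict_eq_zero]; simp
  obtain ⟨y, hy, hxy⟩ := (h2.and (ae_restrict_mem measurableSet_Ioi)).exists
  have := hm x (y - x) hx (sub_pos.2 hxy)
  rw [add_sub_cancel] at this
  exact this.trans hy

theorem exists_isPositiveDensitySolution {m₀ : ℝ → ℝ}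
    (hb : MemLp m₀ ⊤ (volume.restrict (Ioi (0 : ℝ))))
    (hn : ∀ x : ℝ, 0 < x → 0 ≤ m₀ x)
    (hm : ∀ x h : ℝ, 0 < x → 0 < h → m₀ x ≤ m₀ (x + h)) :
    ∃ m, IsPositiveDensitySolution m₀ m := by
  obtain ⟨P, hP⟩ := exists_bound_of_memLp_top hb hm
  -- Extension by zero keeps monotonicity because `m₀ ≥ 0`.
  set v : ℝ → ℝ := indicator (Ioi 0) m₀ with hvdef
  have h0 : ∀ x, 0 ≤ v x := fun x => indicator_nonneg (fun y hy => hn y hy) x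
  have hPv : ∀ x, v x ≤ P := fun x =>
    indicator_le' (fun y hy => hP y hy) (fun _ _ => (hn 1 one_pos).trans (hP 1 one_pos)) x
  have hv : Monotone v := by
    intro x y hxy
    rcases le_or_gt x 0 with hx | hx
    · rw [hvdef, indicator_of_notMem (by simpa using hx)]
      exact h0 y
    · rw [hvdef, indicator_of_mem (show x ∈ Ioi 0 from hx),
        indicator_of_mem (show y ∈ Ioi 0 from hx.trans_le hxy)]
      rcases hxy.eq_or_lt with rfl | h
      · exact le_rfl
      · simpa using hm x (y - x) hx (sub_pos.2 h)
  refine ⟨density v, ⟨memLp_density hv h0 hPv, fun p _ => density_nonneg hv h0 hPv p,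
    fun ψ hψ => ?_⟩, fun x t h _ _ hh => density_mono hv h0 hPv (by linarith)⟩
  have key : ∫ x in Ioi (0 : ℝ), m₀ x * ψ (x, 0) = ∫ x, v x * ψ (x, 0) := by
    rw [← integral_indicator measurableSet_Ioi]
    exact integral_congr_ae (Eventually.of_forall fun x => indicator_mul_left _ _ _)
  rw [key]
  exact density_weak_eq hv h0 hPv hψ

/-! ### Integration by parts against a monotone speed. -/

/-- Against a nonnegative monotone weight, a nonnegative function that vanishes at the right end
point has a nonpositive weighted increment. -/
lemma integral_monotone_mul_deriv_nonpos {b u u' : ℝ → ℝ} {a c : ℝ} (hac : a ≤ c)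
    (hb : Monotone b) (hb0 : ∀ x, 0 ≤ b x) (hu : ∀ x, a ≤ x → HasDerivAt u (u' x) x)
    (hu' : Continuous u') (hu0 : ∀ x, 0 ≤ u x) (huc : ∀ x, c ≤ x → u x = 0) :
    ∫ x in a..c, b x * u' x ≤ 0 := by
  have hcont : ContinuousOn u (Ici a) := fun x hx => (hu x hx).continuousAt.continuousWithinAt
  have hbi : ∀ p q : ℝ, IntervalIntegrable b volume p q := fun p q => hb.intervalIntegrable
  have hbu : ∀ p q : ℝ, a ≤ p → a ≤ q → IntervalIntegrable (fun x => b x * u x) volume p q :=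
    fun p q hp hq => (hbi p q).mul_continuousOn (hcont.mono fun x hx =>
      (le_min hp hq).trans hx.1)
  have hshift : ∀ h : ℝ, 0 < h → IntervalIntegrable (fun x => b x * u (x + h)) volume a c :=
    fun h hh => (hbi a c).mul_continuousOn (hcont.comp (by fun_prop) fun x hx => by
      rw [uIcc_of_le hac] at hx
      exact hx.1.trans (by linarith : x ≤ x + h))
  -- As `b` need not be differentiable, the parts formula is replaced by a shift of difference
  -- quotients: `b (x - h) ≤ b x`.
  have hquot : ∀ h : ℝ, 0 < h → ∫ x in a..c, b x * (h⁻¹ * (u (x + h) - u x)) ≤ 0 := by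
    intro h hh
    have e1 : ∫ x in a..c, b x * (h⁻¹ * (u (x + h) - u x)) =
        h⁻¹ * ((∫ x in a..c, b x * u (x + h)) - ∫ x in a..c, b x * u x) := by
      rw [← intervalIntegral.integral_sub (hshift h hh) (hbu a c le_rfl hac),
        ← intervalIntegral.integral_const_mul]
      congr 1
      funext x
      ring
    have e2 : ∫ x in a..c, b x * u (x + h) = ∫ x in (a + h)..(c + h), b (x - h) * u x := by
      rw [← intervalIntegral.integral_comp_add_right]
      simp
    have hb' : Monotone fun x => b (x - h) := fun x y hxy => hb (by linarith)
    have e3 : ∫ x in (a + h)..(c + h), b (x - h) * u x ≤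
        ∫ x in (a + h)..(c + h), b x * u x := by
      refine intervalIntegral.integral_mono_on (by linarith) ?_
        (hbu _ _ (by linarith) (by linarith)) fun x _ => ?_
      · exact hb'.intervalIntegrable.mul_continuousOn (hcont.mono fun x hx => by
          rw [uIcc_of_le (by linarith)] at hx
          exact (by linarith : a ≤ a + h).trans hx.1)
      · exact mul_le_mul_of_nonneg_right (hb (by linarith)) (hu0 x)
    -- The contribution of the left end is discarded by sign; no condition on `u` at `a` is
    -- required.
    have e4 : ∫ x in (a + h)..(c + h), b x * u x ≤ ∫ x in a..(c + h), b x * u x :=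
      intervalIntegral.integral_mono_interval (by linarith) (by linarith) le_rfl
        (Eventually.of_forall fun x => mul_nonneg (hb0 x) (hu0 x))
        (hbu _ _ le_rfl (by linarith))
    have e5 : ∫ x in a..(c + h), b x * u x = ∫ x in a..c, b x * u x := by
      rw [← intervalIntegral.integral_add_adjacent_intervals (hbu a c le_rfl hac)
        (hbu c (c + h) hac (by linarith))]
      have : ∫ x in c..(c + h), b x * u x = ∫ _ in c..(c + h), (0 : ℝ) := by
        refine intervalIntegral.integral_congr fun x hx => ?_
        rw [uIcc_of_le (by linarith)] at hx
        simp [huc x hx.1]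
      rw [this]
      simp
    rw [e1]
    exact mul_nonpos_of_nonneg_of_nonpos (by positivity) (by linarith)
  obtain ⟨C, hC⟩ := (isCompact_Icc (a := a) (b := c + 1)).exists_bound_of_continuousOn
    hu'.continuousOn
  have hC0 : 0 ≤ C := (norm_nonneg _).trans (hC a ⟨le_rfl, by linarith⟩)
  have hlim : Tendsto (fun h : ℝ => ∫ x in a..c, b x * (h⁻¹ * (u (x + h) - u x))) (𝓝[>] 0)
      (𝓝 (∫ x in a..c, b x * u' x)) := by
    refine intervalIntegral.tendsto_integral_filter_of_dominated_convergence
      (fun _ => b c * C) ?_ ?_ (by simp) ?_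
    · filter_upwards [self_mem_nhdsWithin] with h hh
      have : IntervalIntegrable (fun x => b x * (h⁻¹ * (u (x + h) - u x))) volume a c := by
        have := ((hshift h hh).sub (hbu a c le_rfl hac)).const_mul h⁻¹
        refine this.congr fun x _ => ?_
        change h⁻¹ * (b x * u (x + h) - b x * u x) = b x * (h⁻¹ * (u (x + h) - u x))
        ring
      rw [uIoc_of_le hac]
      exact this.1.aestronglyMeasurable
    · filter_upwards [self_mem_nhdsWithin,
        mem_nhdsWithin_of_mem_nhds (Iio_mem_nhds one_pos)] with h hh hh1
      refine Eventually.of_forall fun x hx => ?_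
      rw [uIoc_of_le hac] at hx
      have hh0 : (0 : ℝ) < h := hh
      have hh1' : h < 1 := hh1
      have h1 : ‖u (x + h) - u x‖ ≤ C * ‖x + h - x‖ :=
        (convex_Icc a (c + 1)).norm_image_sub_le_of_norm_hasDerivWithin_le
          (fun y hy => (hu y hy.1).hasDerivWithinAt) hC ⟨hx.1.le, by linarith [hx.2]⟩
          ⟨by linarith [hx.1], by linarith [hx.2]⟩
      rw [add_sub_cancel_left, Real.norm_of_nonneg hh0.le] at h1
      rw [norm_mul, norm_mul, Real.norm_of_nonneg (hb0 x), norm_inv, Real.norm_of_nonneg hh0.le]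
      refine mul_le_mul (hb hx.2) ?_ (by positivity) (hb0 c)
      rw [inv_mul_le_iff₀ hh0]
      linarith
    · refine Eventually.of_forall fun x hx => ?_
      rw [uIoc_of_le hac] at hx
      have := (hu x hx.1.le).tendsto_slope_zero_right
      simp only [smul_eq_mul] at this
      exact this.const_mul (b x)
  refine le_of_tendsto hlim ?_
  filter_upwards [self_mem_nhdsWithin] with h hh using hquot h hh

/-! ### The secant speed of the flux. -/

/-- The secant slope of `-flux` between `α²` and `β²`. -/
noncomputable def secantSpeed (α β : ℝ) : ℝ := 2 / 3 * ((α ^ 2 + α * β + β ^ 2) / (α + β))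

lemma secantSpeed_nonneg {α β : ℝ} (hα : 0 ≤ α) (hβ : 0 ≤ β) : 0 ≤ secantSpeed α β := by
  unfold secantSpeed
  positivity

lemma secantSpeed_comm (α β : ℝ) : secantSpeed α β = secantSpeed β α := by
  unfold secantSpeed
  rw [add_comm β α]
  ring

lemma secantSpeed_mono_left {α α' β : ℝ} (hα : 0 ≤ α) (hβ : 0 ≤ β) (h : α ≤ α') :
    secantSpeed α β ≤ secantSpeed α' β := by
  rcases (add_nonneg hα hβ).eq_or_lt with h0 | hpos
  -- At `α = β = 0` the quotient takes its default value `0`, which is also the right limiting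
  -- speed.
  · rw [secantSpeed, ← h0, div_zero, mul_zero]
    exact secantSpeed_nonneg (hα.trans h) hβ
  · unfold secantSpeed
    have hpos' : 0 < α' + β := by linarith
    refine mul_le_mul_of_nonneg_left ?_ (by norm_num)
    rw [div_le_div_iff₀ hpos hpos']
    -- This product is the difference of the two sides after cross-multiplication.
    have h1 : 0 ≤ (α' - α) * (α * α' + α * β + α' * β) :=
      mul_nonneg (by linarith) (by have := hα.trans h; positivity)
    nlinarith

lemma secantSpeed_mono {α α' β β' : ℝ} (hα : 0 ≤ α) (hβ : 0 ≤ β) (h : α ≤ α') (h' : β ≤ β') :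
    secantSpeed α β ≤ secantSpeed α' β' := by
  refine (secantSpeed_mono_left hα hβ h).trans ?_
  rw [secantSpeed_comm α' β, secantSpeed_comm α' β']
  exact secantSpeed_mono_left hβ (hα.trans h) h'

lemma flux_eq_sqrt {p : ℝ} (hp : 0 ≤ p) : flux p = -(2 / 3) * √p ^ 3 := by
  unfold flux
  rw [Real.sqrt_eq_rpow, ← Real.rpow_natCast, ← Real.rpow_mul hp]
  norm_num

lemma secantSpeed_mul_sub {p q : ℝ} (hp : 0 ≤ p) (hq : 0 ≤ q) :
    secantSpeed √p √q * (p - q) = flux q - flux p := by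
  rw [flux_eq_sqrt hp, flux_eq_sqrt hq]
  have hα := Real.sqrt_nonneg p
  have hβ := Real.sqrt_nonneg q
  have h1 : p - q = √p ^ 2 - √q ^ 2 := by rw [Real.sq_sqrt hp, Real.sq_sqrt hq]
  rw [h1]
  generalize √p = α at *
  generalize √q = β at *
  unfold secantSpeed
  rcases (add_nonneg hα hβ).eq_or_lt with h0 | hpos
  · have ha : α = 0 := by linarith
    have hb : β = 0 := by linarith
    simp [ha, hb]
  · field_simp
    ring

/-! ### The localized energy estimate. -/

lemma continuous_deriv_smoothTransition : Continuous (deriv smoothTransition) :=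
  (smoothTransition.contDiff (n := 1)).continuous_deriv le_rfl

lemma hasDerivAt_smoothTransition (x : ℝ) :
    HasDerivAt smoothTransition (deriv smoothTransition x) x :=
  ((smoothTransition.contDiff (n := 1)).differentiable (by simp) x).hasDerivAt

lemma deriv_smoothTransition_nonneg (x : ℝ) : 0 ≤ deriv smoothTransition x :=
  smoothTransition.monotone.deriv_nonneg

/-- Energy estimate on the domain of dependence for an approximate solution `W` of the transport
equation `W_t = b W_x` with a speed `b` that is monotone in `x`. -/
lemma energy_estimate {W D G b : ℝ × ℝ → ℝ} {a c T L K τ : ℝ} (hac : a ≤ c) (hL : 0 ≤ L)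
    (hWc : Continuous W) (hD : Continuous D) (hG : Continuous G)
    (hWx : ∀ x t, a ≤ x → 0 ≤ t → t ≤ T → HasDerivAt (fun x => W (x, t)) (D (x, t)) x)
    (hWt : ∀ x t, a ≤ x → 0 ≤ t → t ≤ T → HasDerivAt (fun t => W (x, t)) (G (x, t)) t)
    (hW0 : ∀ x, W (x, 0) = 0) (hWK : ∀ x t, a ≤ x → 0 ≤ t → t ≤ T → |W (x, t)| ≤ K)
    (hbm : AEStronglyMeasurable b) (hb : ∀ t, Monotone fun x => b (x, t))
    (hb0 : ∀ z, 0 ≤ b z) (hbL : ∀ z, b z ≤ L) (hτ0 : 0 ≤ τ) (hτ : τ ≤ T) :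
    ∫ x in a..c, smoothTransition (c - x - L * τ) * W (x, τ) ^ 2 ≤
      2 * K * ∫ z in Icc a c ×ˢ Icc 0 T, |G z - b z * D z| := by
  set η := smoothTransition
  set u : ℝ × ℝ → ℝ := fun z => η (c - z.1 - L * z.2) * W z ^ 2 with hu
  set ux : ℝ × ℝ → ℝ := fun z => -deriv η (c - z.1 - L * z.2) * W z ^ 2 +
    η (c - z.1 - L * z.2) * (2 * W z * D z) with hux
  set ut : ℝ × ℝ → ℝ := fun z => -L * deriv η (c - z.1 - L * z.2) * W z ^ 2 +
    η (c - z.1 - L * z.2) * (2 * W z * G z) with hut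
  have hηc : Continuous η := smoothTransition.continuous
  have hη'c : Continuous (deriv η) := continuous_deriv_smoothTransition
  have huxc : Continuous ux := by fun_prop
  have hutc : Continuous ut := by fun_prop
  have hdx : ∀ x t, a ≤ x → 0 ≤ t → t ≤ T → HasDerivAt (fun x => u (x, t)) (ux (x, t)) x := by
    intro x t hx ht hT
    have h1 : HasDerivAt (fun x => c - x - L * t) (-1) x := by
      simpa using ((hasDerivAt_id x).const_sub c).sub_const (L * t)
    refine (((hasDerivAt_smoothTransition _).comp x h1).mul ((hWx x t hx ht hT).pow 2)).congr_deriv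
      ?_
    simp [hux, η]
  have hdt : ∀ x t, a ≤ x → 0 ≤ t → t ≤ T → HasDerivAt (fun t => u (x, t)) (ut (x, t)) t := by
    intro x t hx ht hT
    have h1 : HasDerivAt (fun t => c - x - L * t) (-L) t := by
      simpa using ((hasDerivAt_id t).const_mul L).const_sub (c - x)
    refine (((hasDerivAt_smoothTransition _).comp t h1).mul ((hWt x t hx ht hT).pow 2)).congr_deriv
      ?_
    simp [hut, η]
    exact Or.inl (by ring)
  have hcpt : ∀ f : ℝ × ℝ → ℝ, Continuous f → ∀ s,
      IntegrableOn f (Icc a c ×ˢ Icc 0 s) := fun f hf s =>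
    hf.continuousOn.integrableOn_compact (isCompact_Icc.prod isCompact_Icc)
  have hsub : Ioc a c ×ˢ Ioc 0 τ ⊆ Icc a c ×ˢ Icc 0 τ :=
    prod_mono Ioc_subset_Icc_self Ioc_subset_Icc_self
  have hsubT : Ioc a c ×ˢ Ioc 0 τ ⊆ Icc a c ×ˢ Icc 0 T :=
    hsub.trans (prod_mono_right (Icc_subset_Icc_right hτ))
  have hbint : ∀ f : ℝ × ℝ → ℝ, Continuous f → ∀ s,
      IntegrableOn (fun z => b z * f z) (Icc a c ×ˢ Icc 0 s) := fun f hf s =>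
    (hcpt f hf s).bdd_mul hbm.restrict (c := L)
      (Eventually.of_forall fun z => by rw [Real.norm_of_nonneg (hb0 z)]; exact hbL z)
  have herr : IntegrableOn (fun z => |G z - b z * D z|) (Icc a c ×ˢ Icc 0 T) :=
    ((hcpt G hG T).sub (hbint D hD T)).abs
  have hleft : ∫ x in a..c, u (x, τ) = ∫ z in Ioc a c ×ˢ Ioc 0 τ, ut z := by
    rw [Measure.volume_eq_prod, setIntegral_prod _
      (by rw [← Measure.volume_eq_prod]; exact (hcpt ut hutc τ).mono_set hsub),
      intervalIntegral.integral_of_le hac]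
    refine setIntegral_congr_fun measurableSet_Ioc fun x hx => ?_
    rw [← intervalIntegral.integral_of_le hτ0,
      intervalIntegral.integral_eq_sub_of_hasDerivAt (f := fun t => u (x, t))]
    · simp [hu, hW0]
    · intro t ht
      rw [uIcc_of_le hτ0] at ht
      exact hdt x t hx.1.le ht.1 (ht.2.trans hτ)
    · exact (hutc.comp (by fun_prop)).intervalIntegrable _ _
  have hright : ∫ z in Ioc a c ×ˢ Ioc 0 τ, b z * ux z ≤ 0 := by
    have hi : IntegrableOn (fun z => b z * ux z) (Ioc a c ×ˢ Ioc 0 τ) :=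
      (hbint ux huxc τ).mono_set hsub
    rw [Measure.volume_eq_prod] at hi ⊢
    rw [IntegrableOn, ← Measure.prod_restrict] at hi
    rw [← Measure.prod_restrict, integral_prod_symm _ hi]
    refine setIntegral_nonpos measurableSet_Ioc fun t ht => ?_
    rw [← intervalIntegral.integral_of_le hac]
    refine integral_monotone_mul_deriv_nonpos (b := fun x => b (x, t)) (u := fun x => u (x, t))
      (u' := fun x => ux (x, t)) hac (hb t) (fun x => hb0 _)
      (fun x hx => hdx x t hx ht.1.le (ht.2.trans hτ)) (huxc.comp (by fun_prop))
      (fun x => mul_nonneg (smoothTransition.nonneg _) (sq_nonneg _)) fun x hx => ?_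
    have h1 : c - x - L * t ≤ 0 := by linarith [mul_nonneg hL ht.1.le]
    simp [hu, η, smoothTransition.zero_of_nonpos h1]
  have hpt : ∀ z ∈ Ioc a c ×ˢ Ioc 0 τ, ut z ≤ b z * ux z + 2 * K * |G z - b z * D z| := by
    rintro ⟨x, t⟩ ⟨hx, ht⟩
    have hK := hWK x t hx.1.le ht.1.le (ht.2.trans hτ)
    -- The cutoff recedes at speed `L ≥ b`, so the terms with its derivative have a favourable sign
    -- in `ut - b ux`; only the commutator `G - b D` remains.
    have h1 : 0 ≤ (L - b (x, t)) * (deriv η (c - x - L * t) * W (x, t) ^ 2) :=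
      mul_nonneg (by linarith [hbL (x, t)])
        (mul_nonneg (deriv_smoothTransition_nonneg _) (sq_nonneg _))
    have h2 : η (c - x - L * t) * (W (x, t) * (G (x, t) - b (x, t) * D (x, t))) ≤
        K * |G (x, t) - b (x, t) * D (x, t)| := by
      refine (le_abs_self _).trans ?_
      rw [abs_mul, abs_mul, abs_of_nonneg (smoothTransition.nonneg _)]
      calc _ ≤ 1 * (|W (x, t)| * |G (x, t) - b (x, t) * D (x, t)|) :=
            mul_le_mul_of_nonneg_right (smoothTransition.le_one _) (by positivity)
        _ ≤ _ := by
            rw [one_mul]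
            exact mul_le_mul_of_nonneg_right hK (abs_nonneg _)
    simp only [hut, hux]
    linarith
  have hK0 : 0 ≤ K := (abs_nonneg _).trans (hWK a 0 le_rfl le_rfl (hτ0.trans hτ))
  calc ∫ x in a..c, u (x, τ) = ∫ z in Ioc a c ×ˢ Ioc 0 τ, ut z := hleft
    _ ≤ ∫ z in Ioc a c ×ˢ Ioc 0 τ, (b z * ux z + 2 * K * |G z - b z * D z|) :=
        setIntegral_mono_on ((hcpt ut hutc τ).mono_set hsub)
          (((hbint ux huxc τ).mono_set hsub).add ((herr.mono_set hsubT).const_mul _))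
          (measurableSet_Ioc.prod measurableSet_Ioc) hpt
    _ = (∫ z in Ioc a c ×ˢ Ioc 0 τ, b z * ux z) +
          2 * K * ∫ z in Ioc a c ×ˢ Ioc 0 τ, |G z - b z * D z| := by
        rw [integral_add ((hbint ux huxc τ).mono_set hsub)
          ((herr.mono_set hsubT).const_mul _), integral_const_mul]
    _ ≤ 0 + 2 * K * ∫ z in Icc a c ×ˢ Icc 0 T, |G z - b z * D z| := by
        refine add_le_add hright (mul_le_mul_of_nonneg_left ?_ (by positivity))
        exact setIntegral_mono_set herr (Eventually.of_forall fun z => abs_nonneg _)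
          hsubT.eventuallyLE
    _ = _ := zero_add _

/-! ### Convolution and one-sided mollifiers. -/

section Convolution

/-- Convolution of a kernel with a function on the plane. -/
noncomputable def planeConv (k f : ℝ × ℝ → ℝ) (z : ℝ × ℝ) : ℝ := ∫ q, f q * k (z - q)

variable {k f : ℝ × ℝ → ℝ} {A : ℝ}

lemma locallyIntegrable_of_abs_le (hf : AEStronglyMeasurable f) (hA : ∀ z, |f z| ≤ A) :
    LocallyIntegrable f := by
  have : MemLp f ⊤ volume := memLp_top_of_bound hf A (Eventually.of_forall hA)
  exact this.locallyIntegrable le_top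

lemma continuous_planeConv (hk : Continuous k) (hc : HasCompactSupport k)
    (hf : LocallyIntegrable f) : Continuous (planeConv k f) :=
  hc.continuous_convolution_right (ContinuousLinearMap.mul ℝ ℝ) hf hk

lemma hasFDerivAt_planeConv (hk : ContDiff ℝ 1 k) (hc : HasCompactSupport k)
    (hf : LocallyIntegrable f) (z : ℝ × ℝ) :
    ∃ f' : ℝ × ℝ →L[ℝ] ℝ, HasFDerivAt (planeConv k f) f' z ∧
      ∀ e, f' e = planeConv (fun q => fderiv ℝ k q e) f z := by
  refine ⟨_, hc.hasFDerivAt_convolution_right (ContinuousLinearMap.mul ℝ ℝ) hf hk z, fun e => ?_⟩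
  rw [convolution_precompR_apply _ hf (hc.fderiv ℝ) (hk.continuous_fderiv one_ne_zero)]
  rfl

lemma differentiable_planeConv (hk : ContDiff ℝ 1 k) (hc : HasCompactSupport k)
    (hf : LocallyIntegrable f) : Differentiable ℝ (planeConv k f) := fun z =>
  (hasFDerivAt_planeConv hk hc hf z).choose_spec.1.differentiableAt

lemma fderiv_planeConv (hk : ContDiff ℝ 1 k) (hc : HasCompactSupport k)
    (hf : LocallyIntegrable f) (z e : ℝ × ℝ) :
    fderiv ℝ (planeConv k f) z e = planeConv (fun q => fderiv ℝ k q e) f z := by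
  obtain ⟨f', h1, h2⟩ := hasFDerivAt_planeConv hk hc hf z
  rw [h1.fderiv, h2]

lemma abs_planeConv_le (hk0 : ∀ z, 0 ≤ k z) (hk : Integrable k) (hk1 : ∫ z, k z = 1)
    (hA : ∀ z, |f z| ≤ A) (z : ℝ × ℝ) : |planeConv k f z| ≤ A := by
  have h1 : ∫ q, A * k (z - q) = A := by
    rw [integral_const_mul, integral_sub_left_eq_self k volume z, hk1, mul_one]
  refine (norm_integral_le_of_norm_le (f := fun q => f q * k (z - q)) ((hk.comp_sub_left z).const_mul A)
    (Eventually.of_forall fun q => ?_)).trans h1.le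
  rw [norm_mul, Real.norm_of_nonneg (hk0 _)]
  exact mul_le_mul_of_nonneg_right (hA q) (hk0 _)

end Convolution

section Kernel

lemma deriv_smoothTransition_eq_zero {x : ℝ} (hx : x ∉ Icc (0 : ℝ) 1) :
    deriv smoothTransition x = 0 := by
  rw [mem_Icc, not_and_or, not_le, not_le] at hx
  rcases hx with h | h
  · have : smoothTransition =ᶠ[𝓝 x] fun _ => 0 := by
      filter_upwards [Iio_mem_nhds h] with y hy using smoothTransition.zero_of_nonpos (le_of_lt hy)
    rw [this.deriv_eq, deriv_const]
  · have : smoothTransition =ᶠ[𝓝 x] fun _ => 1 := by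
      filter_upwards [Ioi_mem_nhds h] with y hy using smoothTransition.one_of_one_le (le_of_lt hy)
    rw [this.deriv_eq, deriv_const]

/-- The derivative of the smooth step of width `ε`. -/
noncomputable def stepBump (ε x : ℝ) : ℝ := ε⁻¹ * deriv smoothTransition (x / ε)

variable {ε : ℝ}

lemma contDiff_stepBump (ε : ℝ) : ContDiff ℝ ∞ (stepBump ε) := by
  have : ContDiff ℝ ∞ (deriv smoothTransition) :=
    ContDiff.deriv' (smoothTransition.contDiff (n := ⊤))
  exact contDiff_const.mul (this.comp (contDiff_id.div_const ε))

lemma stepBump_nonneg (hε : 0 < ε) (x : ℝ) : 0 ≤ stepBump ε x :=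
  mul_nonneg (by positivity) (deriv_smoothTransition_nonneg _)

lemma stepBump_eq_zero (hε : 0 < ε) {x : ℝ} (hx : x ∉ Icc 0 ε) : stepBump ε x = 0 := by
  rw [stepBump, deriv_smoothTransition_eq_zero, mul_zero]
  contrapose! hx
  exact ⟨by have := hx.1; rwa [le_div_iff₀ hε, zero_mul] at this,
    by have := hx.2; rwa [div_le_iff₀ hε, one_mul] at this⟩

lemma hasDerivAt_step (ε x : ℝ) :
    HasDerivAt (fun x => smoothTransition (x / ε)) (stepBump ε x) x := by
  refine ((hasDerivAt_smoothTransition _).comp x ((hasDerivAt_id x).div_const ε)).congr_deriv ?_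
  simp [stepBump]
  ring

lemma hasCompactSupport_stepBump (hε : 0 < ε) : HasCompactSupport (stepBump ε) :=
  HasCompactSupport.intro isCompact_Icc fun _ hx => stepBump_eq_zero hε hx

lemma integral_stepBump (hε : 0 < ε) : ∫ x, stepBump ε x = 1 := by
  have h1 : Tendsto (fun x => smoothTransition (x / ε)) atBot (𝓝 0) := by
    refine tendsto_const_nhds.congr' ?_
    filter_upwards [eventually_le_atBot 0] with x hx
    exact (smoothTransition.zero_of_nonpos (div_nonpos_of_nonpos_of_nonneg hx hε.le)).symm
  have h2 : Tendsto (fun x => smoothTransition (x / ε)) atTop (𝓝 1) := by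
    refine tendsto_const_nhds.congr' ?_
    filter_upwards [eventually_ge_atTop ε] with x hx
    exact (smoothTransition.one_of_one_le (by rwa [le_div_iff₀ hε, one_mul])).symm
  rw [integral_of_hasDerivAt_of_tendsto (hasDerivAt_step ε)
    ((contDiff_stepBump ε).continuous.integrable_of_hasCompactSupport
      (hasCompactSupport_stepBump hε)) h1 h2, sub_zero]

lemma exists_stepBump_le : ∃ C : ℝ, 0 ≤ C ∧ ∀ ε > 0, ∀ x, stepBump ε x ≤ C / ε := by
  obtain ⟨C, hC⟩ := (isCompact_Icc (a := (0 : ℝ)) (b := 1)).exists_bound_of_continuousOn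
    continuous_deriv_smoothTransition.continuousOn
  have hC0 : 0 ≤ C := (norm_nonneg _).trans (hC 0 ⟨le_rfl, zero_le_one⟩)
  refine ⟨C, hC0, fun ε hε x => ?_⟩
  rw [stepBump, div_eq_inv_mul C]
  refine mul_le_mul_of_nonneg_left ?_ (inv_nonneg.2 (le_of_lt hε))
  by_cases h : x / ε ∈ Icc (0 : ℝ) 1
  · exact (le_abs_self _).trans (hC _ h)
  · rwa [deriv_smoothTransition_eq_zero h]

/-- A mollifier on the plane, supported in `[0, ε]²`. -/
noncomputable def squareBump (ε : ℝ) (z : ℝ × ℝ) : ℝ := stepBump ε z.1 * stepBump ε z.2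

lemma continuous_squareBump (ε : ℝ) : Continuous (squareBump ε) :=
  ((contDiff_stepBump ε).continuous.comp continuous_fst).mul
    ((contDiff_stepBump ε).continuous.comp continuous_snd)

lemma squareBump_nonneg (hε : 0 < ε) (z : ℝ × ℝ) : 0 ≤ squareBump ε z :=
  mul_nonneg (stepBump_nonneg hε _) (stepBump_nonneg hε _)

lemma squareBump_eq_zero (hε : 0 < ε) {z : ℝ × ℝ} (hz : z ∉ (Icc 0 ε ×ˢ Icc 0 ε : Set (ℝ × ℝ))) :
    squareBump ε z = 0 := by
  rw [mem_prod, not_and_or] at hz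
  rcases hz with h | h <;> simp [squareBump, stepBump_eq_zero hε h]

lemma hasCompactSupport_squareBump (hε : 0 < ε) : HasCompactSupport (squareBump ε) :=
  HasCompactSupport.intro (isCompact_Icc.prod isCompact_Icc) fun _ hz => squareBump_eq_zero hε hz

lemma integrable_squareBump (hε : 0 < ε) : Integrable (squareBump ε) :=
  (continuous_squareBump ε).integrable_of_hasCompactSupport (hasCompactSupport_squareBump hε)

lemma integral_squareBump (hε : 0 < ε) : ∫ z, squareBump ε z = 1 := by
  simp only [squareBump]
  rw [Measure.volume_eq_prod, integral_prod_mul, integral_stepBump hε, one_mul]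

lemma measureReal_closedBall_plane (z : ℝ × ℝ) {r : ℝ} (hr : 0 < r) :
    volume.real (Metric.closedBall z r) = (2 * r) ^ 2 := by
  rw [← closedBall_prod_same, Measure.volume_eq_prod, measureReal_prod_prod,
    Real.volume_real_closedBall hr.le, Real.volume_real_closedBall hr.le]
  ring

/-- Mollification converges at almost every point. -/
lemma ae_tendsto_planeConv_squareBump {f : ℝ × ℝ → ℝ} (hf : LocallyIntegrable f) :
    ∀ᵐ z, Tendsto (fun ε => planeConv (squareBump ε) f z) (𝓝[>] 0) (𝓝 (f z)) := by
  filter_upwards [IsUnifLocDoublingMeasure.ae_tendsto_average_norm_sub (μ := volume) hf 1] with z hz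
  have havg := hz (ι := ℝ) (l := 𝓝[>] 0) (fun _ => z) (fun ε => ε) tendsto_id (by
    filter_upwards [self_mem_nhdsWithin] with ε hε
    exact Metric.mem_closedBall_self (by have : (0 : ℝ) < ε := hε; linarith))
  obtain ⟨C, hC0, hC⟩ := exists_stepBump_le
  -- The kernel is at most `(C / ε)²` and the ball has area `(2 ε)²`, hence the constant `4 * C ^
  -- 2`.
  have := tendsto_integral_smul_of_tendsto_average_norm_sub (μ := volume)
    (g := fun ε q => squareBump ε (z - q)) (4 * C ^ 2) havg
    (Eventually.of_forall fun ε => hf.integrableOn_isCompact (isCompact_closedBall z ε))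
    (by
      refine tendsto_const_nhds.congr' ?_
      filter_upwards [self_mem_nhdsWithin] with ε hε
      rw [integral_sub_left_eq_self (squareBump ε) volume z, integral_squareBump hε])
    (by
      filter_upwards [self_mem_nhdsWithin] with ε hε q hq
      have h : z - q ∈ (Icc 0 ε ×ˢ Icc 0 ε : Set (ℝ × ℝ)) := by
        by_contra h
        exact hq (squareBump_eq_zero hε h)
      rw [mem_prod] at h
      rw [Metric.mem_closedBall, Prod.dist_eq, max_le_iff, Real.dist_eq, Real.dist_eq, abs_le,
        abs_le]
      simp only [Prod.fst_sub, Prod.snd_sub, mem_Icc] at h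
      have : (0 : ℝ) < ε := hε
      refine ⟨⟨?_, ?_⟩, ⟨?_, ?_⟩⟩ <;> linarith [h.1.1, h.1.2, h.2.1, h.2.2])
    (by
      filter_upwards [self_mem_nhdsWithin] with ε hε q
      have hε0 : (0 : ℝ) < ε := hε
      rw [measureReal_closedBall_plane z hε0, abs_of_nonneg (squareBump_nonneg hε0 _)]
      calc squareBump ε (z - q) ≤ C / ε * (C / ε) :=
            mul_le_mul (hC ε hε0 _) (hC ε hε0 _) (stepBump_nonneg hε0 _) (by positivity)
        _ = 4 * C ^ 2 / (2 * ε) ^ 2 := by field_simp; ring)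
  refine this.congr fun ε => ?_
  simp only [planeConv, smul_eq_mul, mul_comm]

/-- A compactly supported kernel whose time derivative is `squareBump ε` up to time `T + 1`. -/
noncomputable def stepKernel (ε T : ℝ) (z : ℝ × ℝ) : ℝ :=
  stepBump ε z.1 * (smoothTransition (z.2 / ε) * smoothTransition (T + 2 - z.2))

lemma contDiff_stepKernel (ε T : ℝ) : ContDiff ℝ ∞ (stepKernel ε T) := by
  have h : ContDiff ℝ ∞ smoothTransition := smoothTransition.contDiff (n := ⊤)
  exact ((contDiff_stepBump ε).comp contDiff_fst).mul
    ((h.comp (contDiff_snd.div_const ε)).mul (h.comp (contDiff_const.sub contDiff_snd)))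

lemma stepKernel_eq_zero (hε : 0 < ε) {T : ℝ} {z : ℝ × ℝ}
    (hz : z ∉ (Icc 0 ε ×ˢ Icc 0 (T + 2) : Set (ℝ × ℝ))) : stepKernel ε T z = 0 := by
  rw [mem_prod, not_and_or] at hz
  rcases hz with h | h
  · simp [stepKernel, stepBump_eq_zero hε h]
  · rw [mem_Icc, not_and_or, not_le, not_le] at h
    rcases h with h | h
    · rw [stepKernel, smoothTransition.zero_of_nonpos (div_nonpos_of_nonpos_of_nonneg h.le hε.le)]
      simp
    · rw [stepKernel, smoothTransition.zero_of_nonpos (x := T + 2 - z.2) (by linarith)]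
      simp

lemma hasCompactSupport_stepKernel (hε : 0 < ε) (T : ℝ) : HasCompactSupport (stepKernel ε T) :=
  HasCompactSupport.intro (isCompact_Icc.prod isCompact_Icc) fun _ hz => stepKernel_eq_zero hε hz

lemma fderiv_stepKernel (ε : ℝ) {T : ℝ} {z : ℝ × ℝ} (hz : z.2 < T + 1) :
    fderiv ℝ (stepKernel ε T) z (0, 1) = squareBump ε z := by
  obtain ⟨x, t⟩ := z
  have h1 := hasDerivAt_snd_slice ((contDiff_stepKernel ε T).differentiable (by simp)) x t
  have h2 : HasDerivAt (fun t => stepBump ε x * smoothTransition (t / ε))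
      (stepBump ε x * stepBump ε t) t := (hasDerivAt_step ε t).const_mul _
  refine h1.unique (h2.congr_of_eventuallyEq ?_)
  filter_upwards [Iio_mem_nhds hz] with s hs
  have hs' : s < T + 1 := hs
  simp only [stepKernel]
  rw [smoothTransition.one_of_one_le (x := T + 2 - s) (by linarith), mul_one]

end Kernel

/-! ### Mollified potentials of the transport equation. -/

section ApproximatePotential

variable {f δ g : ℝ × ℝ → ℝ} {ε T A : ℝ}

/-- Only `q.2 > 0` matters, where `z.2 - q.2 < T + 1`, so the late cutoff in the kernel is not seen.
-/
lemma planeConv_fderiv_stepKernel (ε : ℝ) (hf0 : ∀ q : ℝ × ℝ, q.2 ≤ 0 → f q = 0) {z : ℝ × ℝ}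
    (hz : z.2 < T + 1) : planeConv (fun q => fderiv ℝ (stepKernel ε T) q (0, 1)) f z =
      planeConv (squareBump ε) f z := by
  refine integral_congr_ae (Eventually.of_forall fun q => ?_)
  rcases le_or_gt q.2 0 with hq | hq
  · simp [hf0 q hq]
  · simp only []
    rw [fderiv_stepKernel]
    simp only [Prod.snd_sub]
    linarith

lemma fderiv_reflect {k : ℝ × ℝ → ℝ} (hk : Differentiable ℝ k) (z q e : ℝ × ℝ) :
    fderiv ℝ (fun q => k (z - q)) q e = -fderiv ℝ k (z - q) e := by
  have h1 : HasFDerivAt (fun q => z - q) (-ContinuousLinearMap.id ℝ (ℝ × ℝ)) q :=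
    (hasFDerivAt_id q).const_sub z
  have h2 : HasFDerivAt (fun q => k (z - q)) _ q := (hk (z - q)).hasFDerivAt.comp q h1
  rw [h2.fderiv]
  simp

/-- The reflected kernel reaches left by at most `ε`, hence stays away from `x = 0`. Its extent in
time is unrestricted, since test functions need not vanish at `t = 0`. -/
lemma isTestFunction_reflect_stepKernel (hε : 0 < ε) (T : ℝ) {z : ℝ × ℝ} (hz : ε < z.1) :
    IsTestFunction fun q => stepKernel ε T (z - q) := by
  refine ⟨(contDiff_stepKernel ε T).comp (contDiff_const.sub contDiff_id), ?_, ?_⟩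
  · exact (hasCompactSupport_stepKernel hε T).comp_homeomorph (Homeomorph.subLeft z)
  · have hcl : IsClosed {q : ℝ × ℝ | z.1 - ε ≤ q.1} := isClosed_le continuous_const continuous_fst
    have hsub : tsupport (fun q => stepKernel ε T (z - q)) ⊆ {q : ℝ × ℝ | z.1 - ε ≤ q.1} := by
      refine closure_minimal (fun q hq => ?_) hcl
      have h : z - q ∈ (Icc 0 ε ×ˢ Icc 0 (T + 2) : Set (ℝ × ℝ)) := by
        by_contra h
        exact hq (stepKernel_eq_zero hε h)
      have h2 := h.1.2
      simp only [Prod.fst_sub] at h2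
      change z.1 - ε ≤ q.1
      linarith
    intro q hq
    have h2 : z.1 - ε ≤ q.1 := hsub hq
    exact ⟨show 0 < q.1 by linarith, mem_univ _⟩

/-- Testing the weak equation with the reflected kernel trades the `x`-derivative against `g` for
the `t`-derivative against `δ`: the potential built from `g` has `W_x` equal to the mollified `δ`.
-/
lemma fderiv_planeConv_stepKernel_fst (hg : LocallyIntegrable g) (hε : 0 < ε)
    (hδ0 : ∀ q : ℝ × ℝ, q.2 ≤ 0 → δ q = 0)
    (hweak : ∀ ψ, IsTestFunction ψ →
      ∫ q, δ q * fderiv ℝ ψ q (0, 1) = ∫ q, g q * fderiv ℝ ψ q (1, 0))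
    {z : ℝ × ℝ} (hz1 : ε < z.1) (hz2 : z.2 < T + 1) :
    fderiv ℝ (planeConv (stepKernel ε T) g) z (1, 0) = planeConv (squareBump ε) δ z := by
  rw [fderiv_planeConv ((contDiff_stepKernel ε T).of_le (by simp))
    (hasCompactSupport_stepKernel hε T) hg, ← planeConv_fderiv_stepKernel ε hδ0 hz2]
  have h := hweak _ (isTestFunction_reflect_stepKernel hε T hz1)
  simp only [fderiv_reflect ((contDiff_stepKernel ε T).differentiable (by simp)), mul_neg,
    integral_neg, neg_inj] at h
  exact h.symm

lemma fderiv_planeConv_stepKernel_snd (hg : LocallyIntegrable g) (hε : 0 < ε)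
    (hg0 : ∀ q : ℝ × ℝ, q.2 ≤ 0 → g q = 0)
    {z : ℝ × ℝ} (hz : z.2 < T + 1) :
    fderiv ℝ (planeConv (stepKernel ε T) g) z (0, 1) = planeConv (squareBump ε) g z := by
  rw [fderiv_planeConv ((contDiff_stepKernel ε T).of_le (by simp))
    (hasCompactSupport_stepKernel hε T) hg, planeConv_fderiv_stepKernel ε hg0 hz]

lemma planeConv_stepKernel_zero (hε : 0 < ε) (hg0 : ∀ q : ℝ × ℝ, q.2 ≤ 0 → g q = 0) (x : ℝ) :
    planeConv (stepKernel ε T) g (x, 0) = 0 := by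
  refine integral_eq_zero_of_ae (Eventually.of_forall fun q => ?_)
  rcases le_or_gt q.2 0 with hq | hq
  · simp [hg0 q hq]
  · change g q * stepKernel ε T ((x, 0) - q) = 0
    rw [stepKernel_eq_zero hε fun h => ?_]
    · simp
    · have := h.2.1
      simp only [Prod.snd_sub] at this
      linarith

/-- The potential starts from zero and its time derivative, a mollification of `g`, is bounded by
`A`. The bound does not depend on `ε`. -/
lemma abs_planeConv_stepKernel_le (hg : LocallyIntegrable g) (hε : 0 < ε)
    (hg0 : ∀ q : ℝ × ℝ, q.2 ≤ 0 → g q = 0)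
    (hA : ∀ z, |g z| ≤ A) {x t : ℝ} (ht : 0 ≤ t) (htT : t ≤ T) :
    |planeConv (stepKernel ε T) g (x, t)| ≤ A * t := by
  have hW : Differentiable ℝ (planeConv (stepKernel ε T) g) :=
    differentiable_planeConv ((contDiff_stepKernel ε T).of_le (by simp))
      (hasCompactSupport_stepKernel hε T) hg
  have h := (convex_Icc 0 t).norm_image_sub_le_of_norm_hasDerivWithin_le
    (f := fun s => planeConv (stepKernel ε T) g (x, s)) (C := A)
    (fun s _ => (hasDerivAt_snd_slice hW x s).hasDerivWithinAt) (fun s hs => by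
      rw [fderiv_planeConv_stepKernel_snd hg hε hg0
        (show ((x, s) : ℝ × ℝ).2 < T + 1 by linarith [hs.2])]
      exact abs_planeConv_le (squareBump_nonneg hε) (integrable_squareBump hε)
        (integral_squareBump hε) hA _)
    (left_mem_Icc.2 ht) (right_mem_Icc.2 ht)
  rwa [planeConv_stepKernel_zero hε hg0, sub_zero, sub_zero, Real.norm_of_nonneg ht] at h

end ApproximatePotential

/-! ### Uniqueness for the transport equation. -/

lemma exists_box_of_isCompact {K : Set (ℝ × ℝ)} (hK : IsCompact K) (hq : K ⊆ quadrant) :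
    ∃ a r : ℝ, 0 < a ∧ a ≤ r ∧ K ⊆ Icc a r ×ˢ Icc 0 r := by
  rcases K.eq_empty_or_nonempty with rfl | hne
  · exact ⟨1, 1, one_pos, le_rfl, empty_subset _⟩
  obtain ⟨z, hz, hmin⟩ := hK.exists_isMinOn hne continuous_fst.continuousOn
  obtain ⟨r, hr⟩ := hK.isBounded.subset_closedBall 0
  have hle : ∀ q ∈ K, q.1 ≤ r ∧ q.2 ≤ r := fun q h => by
    have h1 := hr h
    rw [Metric.mem_closedBall, dist_zero_right] at h1
    exact ⟨(le_abs_self _).trans ((norm_fst_le q).trans h1),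
      (le_abs_self _).trans ((norm_snd_le q).trans h1)⟩
  exact ⟨z.1, r, (hq hz).1, (hle z hz).1, fun q h =>
    ⟨⟨hmin h, (hle q h).1⟩, ⟨le_of_lt (hq h).2, (hle q h).2⟩⟩⟩

/-- A bounded weak solution of `δ_t = (b δ)_x` with zero initial values vanishes if the speed `b`
is bounded, nonnegative and monotone in `x`. -/
theorem ae_eq_zero_of_transport {δ g b : ℝ × ℝ → ℝ} {A A' L : ℝ}
    (hδm : AEStronglyMeasurable δ) (hgm : AEStronglyMeasurable g) (hbm : AEStronglyMeasurable b)
    (hδA : ∀ z, |δ z| ≤ A') (hgA : ∀ z, |g z| ≤ A)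
    (hδ0 : ∀ q : ℝ × ℝ, q.2 ≤ 0 → δ q = 0) (hg0 : ∀ q : ℝ × ℝ, q.2 ≤ 0 → g q = 0)
    (hweak : ∀ ψ, IsTestFunction ψ →
      ∫ q, δ q * fderiv ℝ ψ q (0, 1) = ∫ q, g q * fderiv ℝ ψ q (1, 0))
    (hb : ∀ t, Monotone fun x => b (x, t)) (hb0 : ∀ z, 0 ≤ b z) (hbL : ∀ z, b z ≤ L)
    (hbδ : ∀ z, b z * δ z = g z) : ∀ᵐ z, z ∈ quadrant → δ z = 0 := by
  have hδ := locallyIntegrable_of_abs_le hδm hδA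
  have hg := locallyIntegrable_of_abs_le hgm hgA
  have hL : 0 ≤ L := (hb0 0).trans (hbL 0)
  refine (isOpen_Ioi.prod isOpen_Ioi).ae_eq_zero_of_integral_contDiff_smul_eq_zero
    (hδ.locallyIntegrableOn _) fun φ hφ hφc hφq => ?_
  obtain ⟨a, r, ha, har, hbox⟩ := exists_box_of_isCompact hφc hφq
  have hr : 0 < r := ha.trans_le har
  -- With this `c` the cutoff argument `c - x - L * t` is at least `1` on the support of `φ`, so the
  -- cutoff equals `1` there.
  set c : ℝ := r + L * r + 1 with hc
  have hLr : 0 ≤ L * r := mul_nonneg hL hr.le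
  have hac : a ≤ c := by linarith
  set B : Set (ℝ × ℝ) := Icc a c ×ˢ Icc 0 r with hB
  have hBc : IsCompact B := isCompact_Icc.prod isCompact_Icc
  set D : ℝ → ℝ × ℝ → ℝ := fun ε => planeConv (squareBump ε) δ with hD
  set G : ℝ → ℝ × ℝ → ℝ := fun ε => planeConv (squareBump ε) g with hG
  set W : ℝ → ℝ × ℝ → ℝ := fun ε => planeConv (stepKernel ε r) g with hW
  have hDc : ∀ ε > 0, Continuous (D ε) := fun ε hε =>
    continuous_planeConv (continuous_squareBump ε) (hasCompactSupport_squareBump hε) hδ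
  have hGc : ∀ ε > 0, Continuous (G ε) := fun ε hε =>
    continuous_planeConv (continuous_squareBump ε) (hasCompactSupport_squareBump hε) hg
  have hWd : ∀ ε > 0, Differentiable ℝ (W ε) := fun ε hε =>
    differentiable_planeConv ((contDiff_stepKernel ε r).of_le (by simp))
      (hasCompactSupport_stepKernel hε r) hg
  have hDA : ∀ ε > 0, ∀ z, |D ε z| ≤ A' := fun ε hε => abs_planeConv_le (squareBump_nonneg hε)
    (integrable_squareBump hε) (integral_squareBump hε) hδA
  have hGA : ∀ ε > 0, ∀ z, |G ε z| ≤ A := fun ε hε => abs_planeConv_le (squareBump_nonneg hε)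
    (integrable_squareBump hε) (integral_squareBump hε) hgA
  have hA : 0 ≤ A := (abs_nonneg _).trans (hgA 0)
  set err : ℝ → ℝ := fun ε => ∫ z in B, |G ε z - b z * D ε z| with herr
  set φx : ℝ × ℝ → ℝ := fun z => fderiv ℝ φ z (1, 0) with hφx
  have hφxc : Continuous φx := (hφ.continuous_fderiv (by simp)).clm_apply continuous_const
  have hφx0 : ∀ z, z ∉ tsupport φ → φx z = 0 := fun z hz => by
    have : fderiv ℝ φ z = 0 := by
      by_contra h
      exact hz (support_fderiv_subset ℝ h)
    simp [hφx, this]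
  have hsuppB : ∀ z ∈ tsupport φ, z ∈ B ∧ 1 ≤ c - z.1 - L * z.2 := fun z hz => by
    have h := hbox hz
    have := mul_le_mul_of_nonneg_left h.2.2 hL
    exact ⟨⟨⟨h.1.1, by linarith [h.1.2]⟩, h.2⟩, by linarith [h.1.2]⟩
  have hnear : ∀ᶠ ε in 𝓝[>] (0 : ℝ), 0 < ε ∧ ε < a := by
    filter_upwards [self_mem_nhdsWithin, mem_nhdsWithin_of_mem_nhds (Iio_mem_nhds ha)] with ε h h'
      using ⟨h, h'⟩
  -- the commutator error tends to zero
  have herr0 : Tendsto err (𝓝[>] 0) (𝓝 0) := by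
    have hlim : Tendsto err (𝓝[>] 0) (𝓝 (∫ _ in B, (0 : ℝ))) := by
      refine tendsto_integral_filter_of_dominated_convergence (fun _ => A + L * A') ?_ ?_ ?_ ?_
      · filter_upwards [hnear] with ε hε
        exact (((hGc ε hε.1).aestronglyMeasurable.sub
          (hbm.mul (hDc ε hε.1).aestronglyMeasurable)).norm).restrict
      · filter_upwards [hnear] with ε hε
        refine Eventually.of_forall fun z => ?_
        rw [Real.norm_of_nonneg (abs_nonneg _)]
        refine (abs_sub _ _).trans (add_le_add (hGA ε hε.1 z) ?_)
        rw [abs_mul, abs_of_nonneg (hb0 z)]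
        exact mul_le_mul (hbL z) (hDA ε hε.1 z) (abs_nonneg _) hL
      · exact integrableOn_const hBc.measure_lt_top.ne
      · refine ae_restrict_of_ae ?_
        filter_upwards [ae_tendsto_planeConv_squareBump hδ, ae_tendsto_planeConv_squareBump hg]
          with z h1 h2
        have := (h2.sub (h1.const_mul (b z))).abs
        rwa [hbδ, sub_self, abs_zero] at this
    simpa using hlim
  -- the potentials are small in the energy norm
  have henergy : ∀ ε, 0 < ε ∧ ε < a →
      ∫ z in B, smoothTransition (c - z.1 - L * z.2) * W ε z ^ 2 ≤ 2 * (A * r) * err ε * r := by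
    rintro ε ⟨hε, hεa⟩
    have hcont : Continuous fun z : ℝ × ℝ =>
        smoothTransition (c - z.1 - L * z.2) * W ε z ^ 2 :=
      (smoothTransition.continuous.comp (by fun_prop)).mul ((hWd ε hε).continuous.pow 2)
    have hi : IntegrableOn (fun z : ℝ × ℝ =>
        smoothTransition (c - z.1 - L * z.2) * W ε z ^ 2) B :=
      hcont.continuousOn.integrableOn_compact hBc
    rw [Measure.volume_eq_prod] at hi ⊢
    rw [hB, IntegrableOn, ← Measure.prod_restrict] at hi
    rw [hB, ← Measure.prod_restrict, integral_prod_symm _ hi]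
    have hle : ∀ t ∈ Icc 0 r, ∫ x in Icc a c,
        smoothTransition (c - x - L * t) * W ε (x, t) ^ 2 ≤ 2 * (A * r) * err ε := by
      intro t ht
      rw [integral_Icc_eq_integral_Ioc, ← intervalIntegral.integral_of_le hac]
      refine energy_estimate (D := D ε) (G := G ε) hac hL (hWd ε hε).continuous (hDc ε hε)
        (hGc ε hε) ?_ ?_ (planeConv_stepKernel_zero hε hg0) ?_ hbm hb hb0 hbL ht.1 ht.2
      · intro x t hx _ ht
        exact (hasDerivAt_fst_slice (hWd ε hε) x t).congr_deriv
          (fderiv_planeConv_stepKernel_fst hg hε hδ0 hweak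
            (show ε < ((x, t) : ℝ × ℝ).1 by linarith)
            (show ((x, t) : ℝ × ℝ).2 < r + 1 by linarith))
      · intro x t _ _ ht
        exact (hasDerivAt_snd_slice (hWd ε hε) x t).congr_deriv
          (fderiv_planeConv_stepKernel_snd hg hε hg0
            (show ((x, t) : ℝ × ℝ).2 < r + 1 by linarith))
      · intro x t _ ht0 ht
        exact (abs_planeConv_stepKernel_le hg hε hg0 hgA ht0 ht).trans
          (mul_le_mul_of_nonneg_left ht hA)
    calc _ ≤ ∫ _ in Icc 0 r, 2 * (A * r) * err ε :=
          setIntegral_mono_on hi.integral_prod_right (integrableOn_const (by simp))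
            measurableSet_Icc hle
      _ = _ := by simp [hr.le]; ring
  -- As `D ε` is the `x`-derivative of `W ε` on the support of `φ`, the integral equals `-∫ φx W`.
  -- Young's inequality with a free weight `s` then allows `ε → 0` first and `s → 0` afterwards.
  have hbound : ∀ s > 0, ∀ ε, 0 < ε ∧ ε < a →
      |∫ z, φ z * D ε z| ≤ s * (∫ z in B, φx z ^ 2) + s⁻¹ * (2 * (A * r) * err ε * r) := by
    rintro s hs ε ⟨hε, hεa⟩
    have hWc := (hWd ε hε).continuous
    have hWcd : Continuous fun z => fderiv ℝ (W ε) z (1, 0) := by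
      have : (fun z => fderiv ℝ (W ε) z (1, 0)) =
          planeConv (fun q => fderiv ℝ (stepKernel ε r) q (1, 0)) g :=
        funext fun z => fderiv_planeConv ((contDiff_stepKernel ε r).of_le (by simp))
          (hasCompactSupport_stepKernel hε r) hg z (1, 0)
      rw [this]
      exact continuous_planeConv
        (((contDiff_stepKernel ε r).continuous_fderiv (by simp)).clm_apply continuous_const)
        ((hasCompactSupport_stepKernel hε r).fderiv_apply (𝕜 := ℝ) _) hg
    have h1 : ∫ z, φ z * D ε z = ∫ z, φ z * fderiv ℝ (W ε) z (1, 0) := by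
      refine integral_congr_ae (Eventually.of_forall fun z => ?_)
      by_cases hz : z ∈ tsupport φ
      · obtain ⟨⟨hz1, hz2⟩, -⟩ := hsuppB z hz
        simp only [hD, hW]
        rw [fderiv_planeConv_stepKernel_fst hg hε hδ0 hweak (hεa.trans_le hz1.1)
          (by linarith [hz2.2])]
      · simp [image_eq_zero_of_notMem_tsupport hz]
    have h2 : ∫ z, φ z * fderiv ℝ (W ε) z (1, 0) = -∫ z, φx z * W ε z :=
      integral_mul_fderiv_eq_neg_fderiv_mul_of_integrable
        ((hφxc.mul hWc).integrable_of_hasCompactSupport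
          ((hφc.fderiv_apply (𝕜 := ℝ) _).mul_right))
        ((hφ.continuous.mul hWcd).integrable_of_hasCompactSupport hφc.mul_right)
        ((hφ.continuous.mul hWc).integrable_of_hasCompactSupport hφc.mul_right)
        (fun z _ => hφ.differentiable (by simp) z) (fun z _ => hWd ε hε z)
    have h3 : ∫ z, φx z * W ε z = ∫ z in B, φx z * W ε z := by
      refine (setIntegral_eq_integral_of_forall_compl_eq_zero fun z hz => ?_).symm
      rw [hφx0 z fun h => hz (hsuppB z h).1, zero_mul]
    have hi1 : IntegrableOn (fun z => s * φx z ^ 2) B :=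
      (continuous_const.mul (hφxc.pow 2)).continuousOn.integrableOn_compact hBc
    have hi2 : IntegrableOn (fun z : ℝ × ℝ => s⁻¹ *
        (smoothTransition (c - z.1 - L * z.2) * W ε z ^ 2)) B :=
      (continuous_const.mul ((smoothTransition.continuous.comp (by fun_prop)).mul
        (hWc.pow 2))).continuousOn.integrableOn_compact hBc
    rw [h1, h2, abs_neg, h3]
    calc |∫ z in B, φx z * W ε z|
        ≤ ∫ z in B, (s * φx z ^ 2 +
            s⁻¹ * (smoothTransition (c - z.1 - L * z.2) * W ε z ^ 2)) := by
          refine norm_integral_le_of_norm_le (f := fun z => φx z * W ε z) (hi1.add hi2)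
            (Eventually.of_forall fun z => ?_)
          by_cases hz : z ∈ tsupport φ
          · rw [smoothTransition.one_of_one_le (hsuppB z hz).2, one_mul, norm_mul,
              Real.norm_eq_abs, Real.norm_eq_abs, ← sq_abs (φx z), ← sq_abs (W ε z)]
            generalize |φx z| = p
            generalize |W ε z| = w
            have hsq : s * p ^ 2 + s⁻¹ * w ^ 2 - p * w =
                s⁻¹ * ((s * p - w / 2) ^ 2 + 3 / 4 * w ^ 2) := by
              field_simp
              ring
            have : 0 ≤ s⁻¹ * ((s * p - w / 2) ^ 2 + 3 / 4 * w ^ 2) := by positivity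
            linarith
          · rw [hφx0 z hz, zero_mul, norm_zero]
            have := smoothTransition.nonneg (c - z.1 - L * z.2)
            positivity
      _ = s * (∫ z in B, φx z ^ 2) +
            s⁻¹ * ∫ z in B, smoothTransition (c - z.1 - L * z.2) * W ε z ^ 2 := by
          rw [integral_add hi1 hi2, integral_const_mul, integral_const_mul]
      _ ≤ _ := by
          have := mul_le_mul_of_nonneg_left (henergy ε ⟨hε, hεa⟩) (inv_nonneg.2 hs.le)
          linarith
  have hlim : Tendsto (fun ε => ∫ z, φ z * D ε z) (𝓝[>] 0) (𝓝 (∫ z, φ z * δ z)) := by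
    refine tendsto_integral_filter_of_dominated_convergence (fun z => |φ z| * A') ?_ ?_ ?_ ?_
    · filter_upwards [hnear] with ε hε
      exact (hφ.continuous.mul (hDc ε hε.1)).aestronglyMeasurable
    · filter_upwards [hnear] with ε hε
      refine Eventually.of_forall fun z => ?_
      rw [norm_mul]
      exact mul_le_mul_of_nonneg_left (hDA ε hε.1 z) (abs_nonneg _)
    · exact (hφ.continuous.integrable_of_hasCompactSupport hφc).abs.mul_const A'
    · filter_upwards [ae_tendsto_planeConv_squareBump hδ] with z hz using hz.const_mul (φ z)
  have hfin : ∀ s > 0, |∫ z, φ z * δ z| ≤ s * ∫ z in B, φx z ^ 2 := by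
    intro s hs
    have h1 : Tendsto (fun ε => s * (∫ z in B, φx z ^ 2) + s⁻¹ * (2 * (A * r) * err ε * r))
        (𝓝[>] 0) (𝓝 (s * (∫ z in B, φx z ^ 2) + s⁻¹ * (2 * (A * r) * 0 * r))) :=
      (((herr0.const_mul _).mul_const r).const_mul _).const_add _
    rw [mul_zero, zero_mul, mul_zero, add_zero] at h1
    exact le_of_tendsto_of_tendsto hlim.abs h1 (hnear.mono fun ε hε => hbound s hs ε hε)
  have hzero : |∫ z, φ z * δ z| ≤ 0 := by
    have h1 : Tendsto (fun s : ℝ => s * ∫ z in B, φx z ^ 2) (𝓝[>] 0)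
        (𝓝 (0 * ∫ z in B, φx z ^ 2)) := (tendsto_id.mono_left nhdsWithin_le_nhds).mul_const _
    rw [zero_mul] at h1
    refine ge_of_tendsto h1 ?_
    filter_upwards [self_mem_nhdsWithin] with s hs using hfin s hs
  simpa using hzero

/-! ### Uniqueness of monotone solutions. -/

lemma measurableSet_quadrant : MeasurableSet quadrant := measurableSet_Ioi.prod measurableSet_Ioi

lemma flux_zero : flux 0 = 0 := by simp [flux]

lemma exists_ae_bound {m : ℝ × ℝ → ℝ} (hm : MemLp m ⊤ (volume.restrict quadrant)) :
    ∃ P, 0 ≤ P ∧ ∀ᵐ z ∂volume.restrict quadrant, m z ≤ P := by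
  refine ⟨(eLpNormEssSup m (volume.restrict quadrant)).toReal, ENNReal.toReal_nonneg, ?_⟩
  have hlt : eLpNormEssSup m (volume.restrict quadrant) < ⊤ := by simpa using hm.2
  filter_upwards [ae_le_eLpNormEssSup (f := m) (μ := volume.restrict quadrant)] with z hz
  have := ENNReal.toReal_mono hlt.ne hz
  rw [toReal_enorm] at this
  exact (le_abs_self _).trans this

/-- A solution agrees almost everywhere on the quadrant with a bounded function on the plane that
is monotone in `x` and vanishes off the quadrant. -/
lemma IsPositiveDensitySolution.exists_representative {m₀ : ℝ → ℝ} {m : ℝ × ℝ → ℝ}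
    (hm : IsPositiveDensitySolution m₀ m) :
    ∃ (n : ℝ × ℝ → ℝ) (P : ℝ), AEStronglyMeasurable n ∧ (∀ z, 0 ≤ n z) ∧ (∀ z, n z ≤ P) ∧
      (∀ z, z ∉ quadrant → n z = 0) ∧ (∀ t, Monotone fun x => n (x, t)) ∧
      n =ᵐ[volume.restrict quadrant] m ∧
      ∀ ψ, IsTestFunction ψ →
        ∫ q, (n q * fderiv ℝ ψ q (0, 1) + flux (n q) * fderiv ℝ ψ q (1, 0)) =
          -∫ x in Ioi (0 : ℝ), m₀ x * ψ (x, 0) := by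
  obtain ⟨P, hP0, hP⟩ := exists_ae_bound hm.isWeakSolution.memLp
  -- Truncation at the essential bound changes `m` on a null set only, makes the bound hold
  -- everywhere and preserves monotonicity in `x`.
  set n : ℝ × ℝ → ℝ := indicator quadrant fun z => min (m z) P with hn
  have hoff : ∀ z, z ∉ quadrant → n z = 0 := fun z hz => indicator_of_notMem hz _
  have hin : ∀ z, z ∈ quadrant → n z = min (m z) P := fun z hz => indicator_of_mem hz _
  have hn0 : ∀ z, 0 ≤ n z := fun z =>
    indicator_nonneg (fun q hq => le_min (hm.isWeakSolution.nonneg q hq) hP0) z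
  have hnm : n =ᵐ[volume.restrict quadrant] m := by
    filter_upwards [hP, ae_restrict_mem measurableSet_quadrant] with z h hz
    rw [hin z hz, min_eq_left h]
  refine ⟨n, P, ?_, hn0, fun z => ?_, hoff, fun t x y hxy => ?_, hnm, fun ψ hψ => ?_⟩
  · rw [hn, aestronglyMeasurable_indicator_iff measurableSet_quadrant]
    exact hm.isWeakSolution.memLp.1.inf aestronglyMeasurable_const
  · exact indicator_le' (fun q _ => min_le_right _ _) (fun _ _ => hP0) z
  · by_cases hx : (x, t) ∈ quadrant
    · have hy : (y, t) ∈ quadrant := ⟨lt_of_lt_of_le hx.1 hxy, hx.2⟩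
      simp only [hin _ hx, hin _ hy]
      rcases hxy.eq_or_lt with rfl | h
      · exact le_rfl
      · have := hm.mono x t (y - x) hx.1 hx.2 (sub_pos.2 h)
        rw [add_sub_cancel] at this
        exact min_le_min_right P this
    · simp only [hoff _ hx]
      exact hn0 _
  · rw [← setIntegral_eq_integral_of_forall_compl_eq_zero (s := quadrant) fun z hz => by
      rw [hoff z hz, flux_zero, zero_mul, zero_mul, add_zero]]
    rw [eq_neg_iff_add_eq_zero]
    refine Eq.trans ?_ (hm.isWeakSolution.weak_eq ψ hψ)
    congr 1
    have hdiff : Differentiable ℝ ψ := hψ.smooth.differentiable (by simp)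
    refine integral_congr_ae ?_
    filter_upwards [hnm] with z hz
    rw [hz, (hasDerivAt_fst_slice hdiff z.1 z.2).deriv, (hasDerivAt_snd_slice hdiff z.1 z.2).deriv]

/-- The initial terms cancel in the difference of the weak equations, and the difference of the
fluxes factors through the secant speed. That speed increases in both arguments, so it inherits
monotonicity in `x` from the two solutions. -/
theorem IsPositiveDensitySolution.ae_eq {m₀ : ℝ → ℝ} {m m' : ℝ × ℝ → ℝ}
    (hm : IsPositiveDensitySolution m₀ m) (hm' : IsPositiveDensitySolution m₀ m') :
    m =ᵐ[volume.restrict quadrant] m' := by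
  obtain ⟨n, P, hnm, hn0, hnP, hnq, hnx, hne, hnw⟩ := hm.exists_representative
  obtain ⟨k, Q, hkm, hk0, hkQ, hkq, hkx, hke, hkw⟩ := hm'.exists_representative
  have hfn : AEStronglyMeasurable fun z => flux (n z) :=
    continuous_flux.comp_aestronglyMeasurable hnm
  have hfk : AEStronglyMeasurable fun z => flux (k z) :=
    continuous_flux.comp_aestronglyMeasurable hkm
  have an : ∀ z, |n z| ≤ P := fun z => by rw [abs_of_nonneg (hn0 z)]; exact hnP z
  have ak : ∀ z, |k z| ≤ Q := fun z => by rw [abs_of_nonneg (hk0 z)]; exact hkQ z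
  have afn : ∀ z, |flux (n z)| ≤ -flux P := fun z => by
    rw [abs_of_nonpos (flux_nonpos (hn0 z))]
    exact neg_le_neg (flux_anti (hn0 z) (hnP z))
  have afk : ∀ z, |flux (k z)| ≤ -flux Q := fun z => by
    rw [abs_of_nonpos (flux_nonpos (hk0 z))]
    exact neg_le_neg (flux_anti (hk0 z) (hkQ z))
  have hoff : ∀ q : ℝ × ℝ, q.2 ≤ 0 → q ∉ quadrant := fun q hq h => absurd h.2 (not_lt.2 hq)
  have hbm : AEStronglyMeasurable fun z => secantSpeed √(n z) √(k z) := by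
    have h1 := hnm.aemeasurable.sqrt
    have h2 := hkm.aemeasurable.sqrt
    exact (((((h1.pow_const 2).add (h1.mul h2)).add (h2.pow_const 2)).div
      (h1.add h2)).const_mul (2 / 3)).aestronglyMeasurable
  have key := ae_eq_zero_of_transport (δ := fun z => n z - k z)
    (g := fun z => flux (k z) - flux (n z)) (b := fun z => secantSpeed √(n z) √(k z))
    (A' := P + Q) (A := -flux Q + -flux P) (L := secantSpeed √P √Q)
    (hnm.sub hkm) (hfk.sub hfn) hbm
    (fun z => (abs_sub _ _).trans (add_le_add (an z) (ak z)))
    (fun z => (abs_sub _ _).trans (add_le_add (afk z) (afn z)))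
    (fun q hq => by simp only [hnq q (hoff q hq), hkq q (hoff q hq), sub_self])
    (fun q hq => by simp only [hnq q (hoff q hq), hkq q (hoff q hq), sub_self])
    (fun ψ hψ => by
      have hint : ∀ (f : ℝ × ℝ → ℝ) (C : ℝ) (e : ℝ × ℝ), AEStronglyMeasurable f →
          (∀ z, |f z| ≤ C) → Integrable fun z => f z * fderiv ℝ ψ z e := fun f C e hf hC =>
        (locallyIntegrable_of_abs_le hf hC).integrable_smul_right_of_hasCompactSupport
          ((hψ.smooth.continuous_fderiv (by simp)).clm_apply continuous_const)
          (hψ.compactSupport.fderiv_apply (𝕜 := ℝ) e)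
      have h1 := hint n P (0, 1) hnm an
      have h2 := hint k Q (0, 1) hkm ak
      have h3 := hint _ _ (1, 0) hfn afn
      have h4 := hint _ _ (1, 0) hfk afk
      have h := (hnw ψ hψ).trans (hkw ψ hψ).symm
      rw [integral_add h1 h3, integral_add h2 h4] at h
      simp only [sub_mul]
      rw [integral_sub h1 h2, integral_sub h4 h3]
      linarith)
    (fun t x y hxy => secantSpeed_mono (sqrt_nonneg _) (sqrt_nonneg _)
      (sqrt_le_sqrt (hnx t hxy)) (sqrt_le_sqrt (hkx t hxy)))
    (fun z => secantSpeed_nonneg (sqrt_nonneg _) (sqrt_nonneg _))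
    (fun z => secantSpeed_mono (sqrt_nonneg _) (sqrt_nonneg _)
      (sqrt_le_sqrt (hnP z)) (sqrt_le_sqrt (hkQ z)))
    (fun z => secantSpeed_mul_sub (hn0 z) (hk0 z))
  filter_upwards [hne, hke, ae_restrict_of_ae key, ae_restrict_mem measurableSet_quadrant]
    with z h1 h2 h3 hz
  rw [← h1, ← h2]
  exact sub_eq_zero.1 (h3 hz)

end ShellCrossing

theorem proposition2 (m₀ : ℝ → ℝ)
    (hm₀_bdd : MemLp m₀ ⊤ (volume.restrict (Ioi (0 : ℝ))))
    (hm₀_nonneg : ∀ x : ℝ, 0 < x → 0 ≤ m₀ x)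
    (hm₀_mono : ∀ x h : ℝ, 0 < x → 0 < h → m₀ x ≤ m₀ (x + h)) :
    ∃ m : ℝ × ℝ → ℝ, ShellCrossing.IsPositiveDensitySolution m₀ m ∧
      ∀ m' : ℝ × ℝ → ℝ, ShellCrossing.IsPositiveDensitySolution m₀ m' →
        m' =ᵐ[volume.restrict ShellCrossing.quadrant] m := by
  obtain ⟨m, hm⟩ :=
    ShellCrossing.exists_isPositiveDensitySolution hm₀_bdd hm₀_nonneg hm₀_mono
  exact ⟨m, hm, fun m' hm' => hm'.ae_eq hm⟩
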